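/- **Setting.** Let $L,k,n\ge 1$. Let $\mathcal C$ be a set of latent classes with a discrete probability distribution $\pi$, at least $k+1$ classes having positive probability. Let $b_0,\dots,b_L\ge 1$, let $\mathcal X\subseteq\mathbb R^{d_0}$ be a set with $\|x\|_2\le 3b_0$ for all $x\in\mathcal X$, and let $(\mathcal D_c)_{c\in\mathcal C}$ be probability distributions on $\mathcal X$. Put $\bar{\mathcal D}_c=\sum_{z\ne c}\pi(z)\mathcal D_z/\sum_{z\neq c}\pi(z)$. *Networks.* Let $\sigma_l:\mathbb R^{d_l}\to\mathbb R^{d_l}$ be $\ell^2$-Lipschitz with constant $\rho_l$, let $M^{(l)}\in\mathbb R^{d_l\times d_{l-1}}$ be fixed and $a_l,s_l>0$ ($1\le l\le L$). Let $\mathcal A$ be the set of $\mathbf A=(A^{(1)},\dots,A^{(L)})$ with $\|A^{(l)}\|_\sigma\le s_l$ (spectral norm) and $\|(A^{(l)}-M^{(l)})^\top\|_{2,1}\le a_l$, where $\|\cdot\|_{2,1}$ is the sum of the $\ell^2$ norms of the columns. Let $F^{1\to l}_{\mathbf A}(x)=\sigma_l(A^{(l)}\sigma_{l-1}(\cdots\sigma_1(A^{(1)}x)))$,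 $F_{\mathbf A}=F^{1\to L}_{\mathbf A}$, $W=\max_{1\le l\le L}d_l$, and $$\widehat{\mathcal R}_{\mathcal A}^{2/3}=\sum_{l=1}^L(a_l b_{l-1}\hat\rho_l)^{2/3},\qquad \hat\rho_l=\rho_l\max_{l\le u\le L} b_u^{-1}\prod_{m=l+1}^u s_m\rho_m .$$ *Unsupervised risk.* A tuple $(x,x^+,x_1^-,\dots,x_k^-)$ is drawn by taking $c\sim\pi$ and then, independently, $x,x^+\sim\mathcal D_c$ and $x_i^-\sim\bar{\mathcal D}_c$. The sample $\mathcal S$ consists of $n$ independent tuples. For a loss $\ell:\mathbb R^k\to[0,\infty)$, $\widehat{\mathrm L}_{\mathrm{un}}(f)$ is the average over $\mathcal S$ of $\ell\big(\{f(x_j)^\top(f(x_j^+)-f(x_{ji}^-))\}_{i=1}^k\big)$, and $\mathcal I_{\mathbf A,\mathbf B}$ is the number of tuples $j\in\{1,\dots,n\}$ containing an input $\tilde x$ with $\|F^{1\to l}_{\mathbf A}(\tilde x)\|_2>b_l$ for some $1\le l\le L$. *Loss.* Let $V\subseteq\mathbb R^k$ be the set of all vectors $\{F_{\mathbf A}(x)^\top(F_{\mathbf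 A}(x^+)-F_{\mathbf A}(x_i^-))\}_{i=1}^k$ with $\mathbf A\in\mathcal A$ and $x,x^+,x_i^-\in\mathcal X$. Assume that $\ell:\mathbb R^k\to[0,\infty)$ is $\ell^\infty$-Lipschitz with constant $\eta\ge1$, that $\ell\le M$ on $V$ for some $M>0$, and that $\ell$ is convex on the convex hull of $V$. *Downstream tasks.* A task is a tuple $\mathcal T=(c_0,\dots,c_k)$ of distinct classes, with a label distribution $p_{\mathcal T}$ on $\{0,\dots,k\}$. Let $\mathcal D$ be the law of $k+1$ independent classes drawn from $\pi$, conditioned on being distinct. With $\mu_c=\mathbb E_{x\sim\mathcal D_c}[f(x)]$, the supervised loss of the mean classifier of $f$ on $\mathcal T$ is $$\mathrm L^\mu_{\sup}(\mathcal T,f)=\sum_{j=0}^k p_{\mathcal T}(j)\,\mathbb E_{x\sim\mathcal D_{c_j}}\Big[\ell\big(\{(\mu_{c_j}-\mu_{c_i})^\top f(x)\}_{i\ne j}\big)\Big].$$ For $c\in\mathcal T$ let $P(c,\mathcal T)=k!\,\pi(c)\prod_{c'\in\mathcal T,\,c'\ne c}\frac{\pi(c')}{1-\pi(c)}$ be the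 probability that drawing an unsupervised tuple produces $c$ as the class of the anchor and the other classes of $\mathcal T$, in some order, as the classes of the negative samples, and put $$\rho(\mathcal T)=\frac{\min_{c\in\mathcal T}P(c,\mathcal T)}{(k+1)!\;\mathcal D(\mathcal T)\;\max_j p_{\mathcal T}(j)}\quad\text{if }\mathcal D(\mathcal T)>0,$$ and $\rho(\mathcal T)=0$ otherwise. **Statement (norm-based bound).** There are universal constants $C>0$ and $q\in\mathbb N$ such that, in every setting as above and for every $\delta\in(0,1)$, with probability at least $1-\delta$ over $\mathcal S$, every minimizer $\widehat F_{\mathbf A}$ of $\widehat{\mathrm L}_{\mathrm{un}}$ over $\{F_{\mathbf A}:\mathbf A\in\mathcal A\}$ satisfies (the expectation being finite) $$\mathbb E_{\mathcal T\sim\mathcal D}\big[\rho(\mathcal T)\,\mathrm L^\mu_{\sup}(\mathcal T,\widehat F_{\mathbf A})\big]\le \widehat{\mathrm L}_{\mathrm{un}}(\widehat F_{\mathbf A})+3M\sqrt{\frac{\log(2/\delta)}{2n}}+C\,\frac{\beta\,\widehat{\mathcal R}_{\mathcal A}}{\sqrt n}\,\log(W+1)\,\Lambda^q+\frac{M\,\mathcal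 I_{\mathbf A,\mathbf B}}{n},$$ where $\beta=\max\{\eta b_L^2,M\}$ and $\Lambda=\log(2+n+k+\beta\widehat{\mathcal R}_{\mathcal A})$. In particular $\beta=\eta b_L^2$ whenever $M\le\eta b_L^2$. -/

import Mathlib

open MeasureTheory
open scoped ENNReal NNReal

namespace DCRL

noncomputable section

/-- `ℝ^m` with the Euclidean norm. -/
abbrev Euc (m : ℕ) : Type := EuclideanSpace ℝ (Fin m)

/-! ### Neural networks

Layers are numbered `1, …, L`. The objects of layer `l + 1` (weight matrix, reference matrix,
activation and constants) carry the index `l`, where `l < L`; the widths `d 0, …, d L` (and later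
the activation thresholds `b 0, …, b L`) carry their own index. Values at indices beyond these
ranges play no role. -/

/-- The fixed data of a class of networks with `L` layers: widths, Lipschitz activations,
reference matrices, and the radii of the weight classes. -/
structure NetSpec (L : ℕ) where
  /-- widths -/
  d : ℕ → ℕ
  /-- activations -/
  act : (l : ℕ) → Euc (d (l + 1)) → Euc (d (l + 1))
  /-- Lipschitz constants of the activations -/
  lip : ℕ → ℝ≥0
  act_lip : ∀ l < L, LipschitzWith (lip l) (act l)
  /-- reference matrices -/
  ref : (l : ℕ) → Matrix (Fin (d (l + 1))) (Fin (d l)) ℝ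
  /-- radii for the `(2,1)`-distance to the reference matrices -/
  a : ℕ → ℝ
  /-- bounds for the spectral norms -/
  s : ℕ → ℝ
  a_pos : ∀ l < L, 0 < a l
  s_pos : ∀ l < L, 0 < s l

/-- The spectral norm: the operator norm with respect to the Euclidean norms. -/
def specNorm {p q : ℕ} (A : Matrix (Fin p) (Fin q) ℝ) : ℝ :=
  ‖LinearMap.toContinuousLinearMap (Matrix.toEuclideanLin A)‖

/-- The `(2,1)`-norm: the sum of the Euclidean norms of the columns. -/
def norm21 {p q : ℕ} (A : Matrix (Fin p) (Fin q) ℝ) : ℝ :=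
  ∑ j, Real.sqrt (∑ i, A i j ^ 2)

namespace NetSpec

variable {L : ℕ} (N : NetSpec L)

/-- A choice of weight matrices. -/
abbrev Weights : Type := (l : ℕ) → Matrix (Fin (N.d (l + 1))) (Fin (N.d l)) ℝ

/-- The parameter space: the product of the weight classes of the `L` layers. -/
def params : Set N.Weights :=
  {A | ∀ l < L, specNorm (A l) ≤ N.s l ∧ norm21 (A l - N.ref l).transpose ≤ N.a l}

/-- The sub-network of the first `l` layers. -/
def subnet (A : N.Weights) : (l : ℕ) → Euc (N.d 0) → Euc (N.d l)
  | 0, x => x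
  | l + 1, x => N.act l (Matrix.toEuclideanLin (A l) (subnet A l x))

/-- The network with weights `A`. -/
def net (A : N.Weights) : Euc (N.d 0) → Euc (N.d L) := N.subnet A L

/-- The maximal width of the layers `1, …, L`. -/
def width : ℕ := (Finset.range L).sup fun l => N.d (l + 1)

/-- For layer `l + 1`: its Lipschitz constant times the largest, over the layers `u + 1` from
`l + 1` to `L`, of `1 / b (u + 1)` times the product of `s m * lip m` over the layers `m + 1`
after layer `l + 1` up to layer `u + 1`. -/
def lipHat (b : ℕ → ℝ) (l : ℕ) : ℝ :=
  (N.lip l : ℝ) *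
    ⨆ u : Set.Ico l L, (b ((u : ℕ) + 1))⁻¹ * ∏ m ∈ Finset.Ioc l (u : ℕ), N.s m * (N.lip m : ℝ)

/-- The norm-based complexity of the class. -/
def complexity (b : ℕ → ℝ) : ℝ :=
  (∑ l ∈ Finset.range L, (N.a l * b l * N.lipHat b l) ^ (2 / 3 : ℝ)) ^ (3 / 2 : ℝ)

end NetSpec

/-! ### Unsupervised risk -/

/-- An input tuple: an anchor, a positive sample, and `k` negative samples. -/
abbrev Tuple (m k : ℕ) : Type := Euc m × Euc m × (Fin k → Euc m)

/-- The inputs that occur in a tuple. -/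
def Tuple.inputs {m k : ℕ} (t : Tuple m k) : Set (Euc m) :=
  {t.1, t.2.1} ∪ Set.range t.2.2

/-- The vector `(f(x)ᵀ (f(x⁺) - f(xᵢ⁻)))ᵢ`. -/
def margins {m p k : ℕ} (f : Euc m → Euc p) (t : Tuple m k) : Fin k → ℝ :=
  fun i => inner ℝ (f t.1) (f t.2.1 - f (t.2.2 i))

section Sampling

variable {𝒞 : Type*} (prior : PMF 𝒞) {m : ℕ} (D : 𝒞 → Measure (Euc m))

/-- The law of a negative sample for class `c`: the mixture of the other class-conditional
distributions with weights proportional to `prior`. -/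
def negLaw (c : 𝒞) : Measure (Euc m) :=
  (∑' z : {z : 𝒞 // z ≠ c}, prior z)⁻¹ • Measure.sum fun z : {z : 𝒞 // z ≠ c} => prior z • D z

/-- The law of an input tuple: draw a class `c` from `prior`, then, independently, the anchor and
the positive sample from `D c` and the `k` negative samples from `negLaw c`. -/
def tupleLaw (k : ℕ) : Measure (Tuple m k) :=
  Measure.sum fun c =>
    prior c • (D c).prod ((D c).prod (Measure.pi fun _ : Fin k => negLaw prior D c))

/-- The law of a dataset of `n` independent input tuples. -/
def sampleLaw (k n : ℕ) : Measure (Fin n → Tuple m k) :=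
  Measure.pi fun _ => tupleLaw prior D k

end Sampling

/-- The empirical unsupervised risk of `f`. -/
def empRisk {m p k n : ℕ} (ℓ : (Fin k → ℝ) → ℝ) (S : Fin n → Tuple m k)
    (f : Euc m → Euc p) : ℝ :=
  (∑ j, ℓ (margins f (S j))) / n

namespace NetSpec

variable {L : ℕ} (N : NetSpec L)

/-- `A` minimizes the empirical unsupervised risk over the parameter space. -/
def IsERM {k n : ℕ} (ℓ : (Fin k → ℝ) → ℝ) (S : Fin n → Tuple (N.d 0) k) (A : N.Weights) : Prop :=
  A ∈ N.params ∧ ∀ A' ∈ N.params, empRisk ℓ S (N.net A) ≤ empRisk ℓ S (N.net A')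

/-- The number of tuples of the dataset on which some layer `l ∈ {1, …, L}` has an activation of
norm larger than `b l`. -/
def numViolations {k n : ℕ} (b : ℕ → ℝ) (S : Fin n → Tuple (N.d 0) k) (A : N.Weights) : ℕ :=
  Set.ncard {j : Fin n | ∃ l, 1 ≤ l ∧ l ≤ L ∧ ∃ x ∈ (S j).inputs, b l < ‖N.subnet A l x‖}

/-- All margin vectors that networks of the class produce on tuples of inputs from `X`. -/
def marginSet (k : ℕ) (X : Set (Euc (N.d 0))) : Set (Fin k → ℝ) :=
  {v | ∃ A ∈ N.params, ∃ t : Tuple (N.d 0) k, t.inputs ⊆ X ∧ v = margins (N.net A) t}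

end NetSpec

/-! ### Downstream classification

A `(k + 1)`-way task is an ordered tuple of `k + 1` distinct classes. -/

section Supervised

variable {𝒞 : Type*} {k m : ℕ}

/-- The joint law of an input and its label in the task `T`: the label is the `j`-th class of `T`
with probability `lab j`, and then the input is drawn from that class. -/
def labelledLaw (D : 𝒞 → Measure (Euc m)) (lab : PMF (Fin (k + 1))) (T : Fin (k + 1) ↪ 𝒞) :
    Measure (Euc m × Fin (k + 1)) :=
  Measure.sum fun j => lab j • (D (T j)).prod (Measure.dirac j)

/-- The population supervised risk of the classifier `g` on the task `T`. -/
def supRisk (ℓ : (Fin k → ℝ) → ℝ) (D : 𝒞 → Measure (Euc m)) (lab : PMF (Fin (k + 1)))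
    (T : Fin (k + 1) ↪ 𝒞) (g : Euc m → Fin (k + 1) → ℝ) : ℝ :=
  ∫ z, ℓ (fun i => g z.1 z.2 - g z.1 (z.2.succAbove i)) ∂(labelledLaw D lab T)

/-- The mean classifier of the representation `f` on the task `T`: the score of a class is the
inner product with the mean representation of that class. -/
def meanClassifier {p : ℕ} (D : 𝒞 → Measure (Euc m)) (T : Fin (k + 1) ↪ 𝒞) (f : Euc m → Euc p) :
    Euc m → Fin (k + 1) → ℝ :=
  fun x j => inner ℝ (∫ y, f y ∂(D (T j))) (f x)

/-- The probability of the task `T` when `k + 1` independent classes are drawn from `prior`,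
conditionally on their being distinct. -/
def taskProb (prior : PMF 𝒞) (T : Fin (k + 1) ↪ 𝒞) : ℝ :=
  (∏ i, (prior (T i)).toReal) / ∑' T' : Fin (k + 1) ↪ 𝒞, ∏ i, (prior (T' i)).toReal

/-- The probability that, in the sampling of an unsupervised tuple, the anchor class is the `j`-th
class of `T` and the `k` negative classes are the other classes of `T`, in any order. -/
def anchorProb (prior : PMF 𝒞) (T : Fin (k + 1) ↪ 𝒞) (j : Fin (k + 1)) : ℝ :=
  (k.factorial : ℝ) * ((prior (T j)).toReal *
    ∏ i, ((prior (T (j.succAbove i))).toReal / (1 - (prior (T j)).toReal)))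

/-- The weight of the task `T`: the smallest probability that the unsupervised sampling produces
the classes of `T` with a given one of them as anchor, relative to the probability
`(k + 1)! * taskProb prior T` of that set of classes as a task, and divided by the largest label
probability. -/
def taskWeight (prior : PMF 𝒞) (lab : PMF (Fin (k + 1))) (T : Fin (k + 1) ↪ 𝒞) : ℝ :=
  (⨅ j, anchorProb prior T j) / (((k + 1).factorial : ℝ) * taskProb prior T) /
    ⨆ j, (lab j).toReal

end Supervised

end

end DCRL

/-! The supervised side rests on Jensen's inequality. For a fixed input, the margins of the mean
classifier are the means of the unsupervised margins over the positive and negative samples.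
Convexity therefore bounds the supervised loss by the expected loss of a tuple whose classes are
prescribed by the task. The weight ρ(T) is built so that D(T) ρ(T) p_T(j) is at most P(c_j, T) /
(k+1)!. Distinct ordered tasks with a fixed position as anchor are distinct outcomes of the class
sampling, so averaging over the k+1 positions bounds the weighted risk by the population
unsupervised risk (`summable_and_tsum_supRisk_le`).

The statistical side bounds that population risk uniformly over the class, hence at any minimizer.
The thresholds b_l do not bound the activations a priori, so the loss is replaced by `augLoss`,
which takes values in [0, M], dominates the loss on admissible tuples, and costs at most M extra on
each violating tuple. A covering network then needs to be accurate only up to the first layer where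
it exceeds 3 b_l: every network it approximates exceeds 2 b_l there, and its augmented loss is
exactly M (`abs_augLoss_sub_le_of_approx`).

The covers come from a greedy argument. Rows with a large image at some data point can be shortened
by a fixed amount by subtracting a discretized multiple of that point, so after boundedly many
corrections the image is small everywhere (`exists_rows_cover`). The correction count does not
depend on the dimensions; the number of choices at each step involves only the number of rows and of
points. Splitting the accuracy between layers in proportion to the 2/3 powers gives metric entropy
of order R²/ε², up to logarithms (`exists_cover_of_complexity_le`).

With this entropy all dyadic scales contribute equally to the chaining bound, which costs a factor
log n (`exists_signAvg_le_of_dyadic_nets`). Symmetrization and McDiarmid's inequality turn it into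
the high-probability bound `measure_deviation_le`. -/

namespace DCRL

/-! ### Greedy covering of row systems with bounded sum of norms. -/

section LayerCover

variable {E : Type*} [NormedAddCommGroup E] [InnerProductSpace ℝ E]

/-- Rounding a real number towards zero on a grid of mesh `u ≤ |v|` loses at most half of it. -/
lemma exists_int_grid {u v : ℝ} (hu : 0 < u) (huv : u ≤ |v|) :
    ∃ m : ℤ, (m.natAbs : ℝ) ≤ |v| / u ∧ (m * u) ^ 2 ≤ (m * u) * v ∧ v ^ 2 ≤ 2 * ((m * u) * v) := by
  have h1 : (1 : ℝ) ≤ |v| / u := by rwa [le_div_iff₀ hu, one_mul]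
  have hf : ((⌊|v| / u⌋₊ : ℕ) : ℝ) ≤ |v| / u := Nat.floor_le (by positivity)
  have hf' : |v| / u < (⌊|v| / u⌋₊ : ℕ) + 1 := Nat.lt_floor_add_one _
  have hf1 : (1 : ℝ) ≤ (⌊|v| / u⌋₊ : ℕ) := by
    exact_mod_cast Nat.le_floor (by simpa using h1)
  set p := ⌊|v| / u⌋₊
  have e1 : (p : ℝ) * u ≤ |v| := by rwa [le_div_iff₀ hu] at hf
  have e2 : |v| ≤ 2 * (p * u) := by
    rw [div_lt_iff₀ hu] at hf'
    nlinarith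
  have hp : 0 ≤ (p : ℝ) * u := by positivity
  rcases le_total 0 v with hv | hv
  · rw [abs_of_nonneg hv] at e1 e2 hf
    refine ⟨p, by simpa [abs_of_nonneg hv] using hf, ?_, ?_⟩ <;> push_cast <;> nlinarith
  · rw [abs_of_nonpos hv] at e1 e2 hf
    refine ⟨-p, by simpa [abs_of_nonpos hv] using hf, ?_, ?_⟩ <;> push_cast <;> nlinarith

/-- One correction step: if the rows `w` are not small on the point `z`, then subtracting a
multiple of `z`, taken from a finite set, from one of the rows decreases the sum of their norms
by a fixed amount. -/
lemma exists_row_correction {d : ℕ} {a B ε : ℝ} (ha : 0 < a) (hB : 0 < B) (hε : 0 < ε)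
    (w : Fin d → E) (hw : ∑ i, ‖w i‖ ≤ a) (z : E) (hz : ‖z‖ ≤ B)
    (hbad : ε ^ 2 < ∑ i, (inner ℝ (w i) z) ^ 2) :
    ∃ (i : Fin d) (m : ℤ), (m.natAbs : ℝ) ≤ a ^ 2 * B ^ 2 / ε ^ 2 ∧
      ∑ j, ‖(w - (Pi.single i ((m * (ε ^ 2 / (a * B)) / B ^ 2) • z) : Fin d → E)) j‖
        ≤ ∑ j, ‖w j‖ - ε ^ 2 / (4 * a * B ^ 2) := by
  -- Pigeonhole with the weights `‖w i‖ / a`, whose sum is at most one.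
  obtain ⟨i, hi⟩ : ∃ i, ε ^ 2 * ‖w i‖ / a < (inner ℝ (w i) z) ^ 2 := by
    by_contra! h
    have := Finset.sum_le_sum (fun i (_ : i ∈ Finset.univ) => h i)
    rw [← Finset.sum_div, ← Finset.mul_sum] at this
    have h2 : ε ^ 2 * (∑ i, ‖w i‖) / a ≤ ε ^ 2 := by
      rw [div_le_iff₀ ha]; gcongr
    linarith
  set v : ℝ := inner ℝ (w i) z
  -- The mesh is at most `|v|`, because `u * |v| ≤ ε ^ 2 * ‖w i‖ / a < v ^ 2`. Since `|v| ≤ a * B`,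
  -- at most `a * B / u = a ^ 2 * B ^ 2 / ε ^ 2` multiples are needed.
  set u : ℝ := ε ^ 2 / (a * B) with hu_def
  have hu : 0 < u := by positivity
  have hwa : ‖w i‖ ≤ a :=
    (Finset.single_le_sum (fun j _ => norm_nonneg (w j)) (Finset.mem_univ i)).trans hw
  have hv : |v| ≤ ‖w i‖ * B :=
    (abs_real_inner_le_norm _ _).trans (by gcongr)
  have hv0 : 0 < |v| := by
    have : 0 < v ^ 2 := lt_of_le_of_lt (by positivity) hi
    exact abs_pos.2 (fun h => by simp [h] at this)
  have huv : u ≤ |v| := by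
    have h1 : u * |v| ≤ |v| * |v| := by
      calc u * |v| ≤ u * (‖w i‖ * B) := by gcongr
        _ = ε ^ 2 * ‖w i‖ / a := by rw [hu_def]; field_simp
        _ ≤ v ^ 2 := hi.le
        _ = |v| * |v| := by rw [abs_mul_abs_self, sq]
    exact le_of_mul_le_mul_right h1 hv0
  obtain ⟨m, hm1, hm2, hm3⟩ := exists_int_grid hu huv
  refine ⟨i, m, hm1.trans ?_, ?_⟩
  · rw [div_le_iff₀ hu]
    calc |v| ≤ a * B := hv.trans (by gcongr)
      _ = a ^ 2 * B ^ 2 / ε ^ 2 * u := by rw [hu_def]; field_simp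
  set t : ℝ := m * u
  set g : ℝ := ε ^ 2 / (4 * a * B ^ 2) with hg
  -- Expanding the square, the quadratic term is at most `t ^ 2 / B ^ 2 ≤ t * v / B ^ 2`, half of
  -- the linear gain. A decrease by `t * v / B ^ 2 ≥ v ^ 2 / (2 * B ^ 2) ≥ 2 * ‖w i‖ * g` remains.
  have hsq : ‖w i - (t / B ^ 2) • z‖ ^ 2 ≤ ‖w i‖ ^ 2 - 2 * ‖w i‖ * g := by
    rw [norm_sub_sq_real, inner_smul_right, norm_smul, mul_pow, Real.norm_eq_abs, sq_abs]
    have h1 : (t / B ^ 2) ^ 2 * ‖z‖ ^ 2 ≤ (t / B ^ 2) ^ 2 * B ^ 2 := by gcongr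
    have h2 : (t / B ^ 2) ^ 2 * B ^ 2 = t ^ 2 / B ^ 2 := by field_simp
    have h3 : t / B ^ 2 * v = t * v / B ^ 2 := by ring
    have h4 : t ^ 2 / B ^ 2 ≤ t * v / B ^ 2 := by gcongr
    have h5 : v ^ 2 / B ^ 2 ≤ 2 * (t * v) / B ^ 2 := by gcongr
    have h6 : 4 * ‖w i‖ * g ≤ v ^ 2 / B ^ 2 := by
      calc 4 * ‖w i‖ * g = (ε ^ 2 * ‖w i‖ / a) / B ^ 2 := by rw [hg]; field_simp
        _ ≤ _ := by gcongr
    have h7 : 2 * (t * v) / B ^ 2 = 2 * (t * v / B ^ 2) := by ring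
    change ‖w i‖ ^ 2 - 2 * (t / B ^ 2 * v) + _ ≤ _
    linarith
  have hg0 : 0 < g := by positivity
  have hwi : 0 < ‖w i‖ := by
    by_contra! h
    have : ‖w i‖ = 0 := le_antisymm h (norm_nonneg _)
    rw [this] at hv; linarith
  have h2g : 2 * g ≤ ‖w i‖ := by
    have : 0 ≤ ‖w i‖ * (‖w i‖ - 2 * g) := by
      have := sq_nonneg ‖w i - (t / B ^ 2) • z‖; nlinarith
    nlinarith
  have hnorm : ‖w i - (t / B ^ 2) • z‖ ≤ ‖w i‖ - g := by
    apply abs_le_of_sq_le_sq' _ (by linarith) |>.2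
    nlinarith
  rw [← Finset.add_sum_erase _ _ (Finset.mem_univ i),
    ← Finset.add_sum_erase (a := i) (f := fun j => ‖w j‖) _ (Finset.mem_univ i)]
  have hrest : ∑ j ∈ Finset.univ.erase i, ‖(w - (Pi.single i ((t / B ^ 2) • z) : Fin d → E)) j‖
      = ∑ j ∈ Finset.univ.erase i, ‖w j‖ := by
    refine Finset.sum_congr rfl fun j hj => ?_
    simp [Finset.ne_of_mem_erase hj]
  rw [hrest]
  simp only [Pi.sub_apply, Pi.single_eq_same]
  linarith

open scoped Classical in
/-- The greedy covering of the rows with bounded sum of norms, in the maximum over a finite set of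
points; its size does not depend on the dimension of `E`. -/
lemma exists_rows_cover {d : ℕ} {P : Type*} [Fintype P] {a B ε : ℝ} (ha : 0 < a) (hB : 0 < B)
    (hε : 0 < ε) (z : P → E) (hz : ∀ p, ‖z p‖ ≤ B) (t : ℕ) :
    ∃ F : Finset (Fin d → E), 0 ∈ F ∧
      F.card ≤ (1 + d * Fintype.card P * (2 * ⌊a ^ 2 * B ^ 2 / ε ^ 2⌋₊ + 1)) ^ t ∧
      ∀ w : Fin d → E, ∑ i, ‖w i‖ ≤ a → ∑ i, ‖w i‖ < (t + 1) * (ε ^ 2 / (4 * a * B ^ 2)) →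
        ∃ w' ∈ F, ∀ p, ∑ i, (inner ℝ (w i - w' i) (z p)) ^ 2 ≤ ε ^ 2 := by
  set m := ⌊a ^ 2 * B ^ 2 / ε ^ 2⌋₊ with hm
  set g := ε ^ 2 / (4 * a * B ^ 2) with hg
  have hg0 : 0 < g := by positivity
  induction t with
  | zero =>
    refine ⟨{0}, by simp, by simp, fun w hw hlt => ⟨0, by simp, fun p => ?_⟩⟩
    -- A bad point would allow a decrease by `g` of a sum that is already below `g`.
    by_contra! h
    simp only [Pi.zero_apply, sub_zero] at h
    obtain ⟨i, k, -, hk⟩ := exists_row_correction ha hB hε w hw (z p) (hz p) h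
    have : 0 ≤ ∑ j, ‖(w - (Pi.single i ((k * (ε ^ 2 / (a * B)) / B ^ 2) • z p) : Fin d → E)) j‖ :=
      Finset.sum_nonneg fun _ _ => norm_nonneg _
    simp only [Nat.cast_zero, zero_add, one_mul] at hlt
    linarith
  | succ t ih =>
    obtain ⟨F, hF0, hF, hcov⟩ := ih
    -- `none` is the zero correction, so that the cover contains the one of the previous stage.
    let step : Option (Fin d × P × Finset.Icc (-(m : ℤ)) m) → (Fin d → E) := fun o =>
      o.elim 0 fun q => Pi.single q.1 (((q.2.2 : ℤ) * (ε ^ 2 / (a * B)) / B ^ 2) • z q.2.1)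
    let F' := F.biUnion fun w => Finset.univ.image fun o => step o + w
    have hcardstep : Fintype.card (Option (Fin d × P × Finset.Icc (-(m : ℤ)) m))
        = 1 + d * Fintype.card P * (2 * m + 1) := by
      simp only [Fintype.card_option, Fintype.card_prod, Fintype.card_fin, Fintype.card_coe,
        Int.card_Icc]
      have : ((m : ℤ) + 1 - -(m : ℤ)).toNat = 2 * m + 1 := by omega
      rw [this]; ring
    have hmem : ∀ w ∈ F, ∀ o, step o + w ∈ F' := fun w hw o =>
      Finset.mem_biUnion.2 ⟨w, hw, Finset.mem_image.2 ⟨o, Finset.mem_univ _, rfl⟩⟩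
    have h0 : 0 ∈ F' := by simpa [step] using hmem 0 hF0 none
    refine ⟨F', h0, ?_, fun w hw hlt => ?_⟩
    · rw [pow_succ]
      refine (Finset.card_biUnion_le_card_mul _ _
        (1 + d * Fintype.card P * (2 * m + 1)) fun w _ => ?_).trans (by gcongr)
      rw [← hcardstep]
      exact Finset.card_image_le.trans (by simp)
    -- Either the previous cover applies, or zero already approximates the rows, or one correction
    -- brings the sum of norms within reach of the previous cover.
    · by_cases hgood : ∑ i, ‖w i‖ < (t + 1) * g
      · obtain ⟨w', hw', h⟩ := hcov w hw hgood
        exact ⟨step none + w', hmem _ hw' _, by simpa [step] using h⟩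
      by_cases hsmall : ∀ p, ∑ i, (inner ℝ (w i) (z p)) ^ 2 ≤ ε ^ 2
      · exact ⟨0, h0, by simpa using hsmall⟩
      · push Not at hsmall
        obtain ⟨p, hp⟩ := hsmall
        obtain ⟨i, k, hk1, hk⟩ := exists_row_correction ha hB hε w hw (z p) (hz p) hp
        have hkm : k.natAbs ≤ m := Nat.le_floor hk1
        let o : Option (Fin d × P × Finset.Icc (-(m : ℤ)) m) :=
          some (i, p, ⟨k, by rw [Finset.mem_Icc]; omega⟩)
        obtain ⟨w', hw', h⟩ := hcov (w - step o) (by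
            refine hk.trans (by linarith)) (by
            refine hk.trans_lt ?_
            push_cast at hlt; linarith)
        refine ⟨step o + w', hmem _ hw' _, fun q => ?_⟩
        simpa [sub_sub] using h q

end LayerCover
end DCRL

namespace DCRL

/-! ### Covering of the weight matrices of one layer. -/

section MatrixCover

lemma norm_toEuclideanLin_sq {p q : ℕ} (A : Matrix (Fin p) (Fin q) ℝ) (z : Euc q) :
    ‖Matrix.toEuclideanLin A z‖ ^ 2 = ∑ i, (inner ℝ (WithLp.toLp 2 (A i) : Euc q) z) ^ 2 := by
  rw [EuclideanSpace.norm_sq_eq]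
  refine Finset.sum_congr rfl fun i _ => ?_
  rw [Real.norm_eq_abs, sq_abs]
  congr 1
  simp [Matrix.toLpLin_apply, Matrix.mulVec, dotProduct, PiLp.inner_apply, mul_comm]

lemma norm21_transpose {p q : ℕ} (A : Matrix (Fin p) (Fin q) ℝ) :
    norm21 A.transpose = ∑ i, ‖(WithLp.toLp 2 (A i) : Euc q)‖ := by
  simp [norm21, EuclideanSpace.norm_eq]

lemma norm_toEuclideanLin_le {p q : ℕ} (A : Matrix (Fin p) (Fin q) ℝ) (z : Euc q) :
    ‖Matrix.toEuclideanLin A z‖ ≤ specNorm A * ‖z‖ :=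
  (LinearMap.toContinuousLinearMap (Matrix.toEuclideanLin A)).le_opNorm z

open scoped Classical in
/-- Matrices with bounded `(2,1)`-norm of the transpose are covered, in the maximal Euclidean norm
of the images of finitely many points, by a set whose size depends only logarithmically on the
number of rows and not on the number of columns. -/
lemma exists_matrix_cover {p q : ℕ} {P : Type*} [Fintype P] {a B ε : ℝ} (ha : 0 < a) (hB : 0 < B)
    (hε : 0 < ε) (z : P → Euc q) (hz : ∀ x, ‖z x‖ ≤ B) :
    ∃ F : Finset (Matrix (Fin p) (Fin q) ℝ),
      F.card ≤ (1 + p * Fintype.card P * (2 * ⌊a ^ 2 * B ^ 2 / ε ^ 2⌋₊ + 1)) ^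
        ⌊4 * a ^ 2 * B ^ 2 / ε ^ 2⌋₊ ∧
      ∀ A : Matrix (Fin p) (Fin q) ℝ, norm21 A.transpose ≤ a →
        ∃ A' ∈ F, ∀ x, ‖Matrix.toEuclideanLin (A - A') (z x)‖ ≤ ε := by
  -- The number of corrections is the initial sum `a` divided by the decrease `ε ^ 2 / (4 * a * B ^
  -- 2)`.
  obtain ⟨F, -, hF, hcov⟩ := exists_rows_cover (d := p) ha hB hε z hz
    ⌊4 * a ^ 2 * B ^ 2 / ε ^ 2⌋₊
  refine ⟨F.image fun w i j => w i j, Finset.card_image_le.trans hF, fun A hA => ?_⟩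
  rw [norm21_transpose] at hA
  obtain ⟨w, hw, h⟩ := hcov (fun i => WithLp.toLp 2 (A i)) hA (by
    refine hA.trans_lt ?_
    have := Nat.lt_floor_add_one (4 * a ^ 2 * B ^ 2 / ε ^ 2)
    rw [← div_lt_iff₀ (by positivity)]
    convert this using 1
    field_simp)
  refine ⟨_, Finset.mem_image.2 ⟨w, hw, rfl⟩, fun x => ?_⟩
  refine abs_le_of_sq_le_sq' ?_ hε.le |>.2
  rw [norm_toEuclideanLin_sq]
  exact h x

end MatrixCover

/-! ### Covering of networks layer by layer, and propagation of errors. -/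

namespace NetSpec

variable {L : ℕ} (N : NetSpec L)

lemma subnet_congr {A A' : N.Weights} {l : ℕ} (h : ∀ i < l, A i = A' i) :
    N.subnet A l = N.subnet A' l := by
  induction l with
  | zero => rfl
  | succ l ih =>
    funext x
    simp only [subnet]
    rw [ih fun i hi => h i (by omega), h l (by omega)]

/-- The propagation of errors `e i`, committed at the input of the activations, through the
network. -/
def errBound (e : ℕ → ℝ) : ℕ → ℝ
  | 0 => 0
  | l + 1 => N.lip l * (N.s l * errBound e l + e l)

open scoped Classical in
/-- Covers of the single layers give a cover of the class of networks on a finite set of inputs: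
the approximation holds up to the first layer at which the approximating network exceeds the
thresholds. -/
lemma exists_weights_cover {P : Type*} (x : P → Euc (N.d 0)) (b : ℕ → ℝ) (hb : ∀ l ≤ L, 0 ≤ b l)
    (e : ℕ → ℝ) (c : ℕ → ℕ)
    (hc : ∀ i < L, ∀ z : P → Euc (N.d i), (∀ p, ‖z p‖ ≤ b i) →
      ∃ F : Finset (Matrix (Fin (N.d (i + 1))) (Fin (N.d i)) ℝ), F.card ≤ c i ∧
        ∀ Δ : Matrix (Fin (N.d (i + 1))) (Fin (N.d i)) ℝ, norm21 Δ.transpose ≤ N.a i →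
          ∃ Δ' ∈ F, ∀ p,
          N.lip i * ‖Matrix.toEuclideanLin (Δ - Δ') (z p)‖ ≤ N.lip i * e i)
    (l : ℕ) (hl : l ≤ L) :
    ∃ F : Finset N.Weights, F.card ≤ ∏ i ∈ Finset.range l, c i ∧
      ∀ A ∈ N.params, ∃ A' ∈ F, ∀ p, ∀ u ≤ l, (∀ v < u, ‖N.subnet A' v (x p)‖ ≤ b v) →
        ‖N.subnet A u (x p) - N.subnet A' u (x p)‖ ≤ N.errBound e u := by
  induction l with
  | zero =>
    refine ⟨{0}, by simp, fun A _ => ⟨0, by simp, fun p u hu _ => ?_⟩⟩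
    obtain rfl : u = 0 := by omega
    simp [subnet, errBound]
  | succ l ih =>
    obtain ⟨F, hF, hcov⟩ := ih (by omega)
    have hlL : l < L := by omega
    -- Inputs above the threshold are replaced by zero, so that the single-layer cover applies to
    -- all points. The approximation claim for later layers excludes those points.
    let z : N.Weights → P → Euc (N.d l) := fun A' p =>
      if ‖N.subnet A' l (x p)‖ ≤ b l then N.subnet A' l (x p) else 0
    have hz : ∀ A' p, ‖z A' p‖ ≤ b l := fun A' p => by
      by_cases h : ‖N.subnet A' l (x p)‖ ≤ b l
      · simp only [z, if_pos h, h]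
      · simp only [z, if_neg h, norm_zero, hb l hlL.le]
    choose Fl hFl hcovl using fun A' => hc l hlL (z A') (hz A')
    refine ⟨F.biUnion fun A' => (Fl A').image fun Δ => Function.update A' l (N.ref l + Δ), ?_, ?_⟩
    · rw [Finset.prod_range_succ]
      exact (Finset.card_biUnion_le_card_mul _ _ (c l)
        fun A' _ => Finset.card_image_le.trans (hFl A')).trans (by gcongr)
    · intro A hA
      obtain ⟨A', hA', happrox⟩ := hcov A hA
      obtain ⟨Δ, hΔ, hΔapprox⟩ := hcovl A' (A l - N.ref l) (hA l hlL).2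
      refine ⟨_, Finset.mem_biUnion.2 ⟨A', hA', Finset.mem_image.2 ⟨Δ, hΔ, rfl⟩⟩, ?_⟩
      intro p u hu halive
      set A'' := Function.update A' l (N.ref l + Δ) with hA''
      have hsub : ∀ v ≤ l, N.subnet A'' v = N.subnet A' v := fun v hv =>
        N.subnet_congr fun i hi => by
          rw [hA'', Function.update_of_ne (by omega)]
      rcases Nat.lt_or_ge u (l + 1) with hul | hul
      · rw [hsub u (by omega)]
        exact happrox p u (by omega) fun v hv => by
          rw [← hsub v (by omega)]; exact halive v hv
      obtain rfl : u = l + 1 := by omega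
      have h1 := happrox p l le_rfl fun v hv => by
        rw [← hsub v (by omega)]; exact halive v (by omega)
      have h2 : ‖N.subnet A' l (x p)‖ ≤ b l := by
        rw [← hsub l le_rfl]; exact halive l (by omega)
      have h3 := hΔapprox p
      simp only [z, if_pos h2] at h3
      simp only [subnet, errBound]
      rw [hsub l le_rfl, hA'', Function.update_self]
      refine (N.act_lip l hlL).norm_sub_le _ _ |>.trans ?_
      -- The true matrix acts on the inherited error and contributes `s l`. The matrix error acts on
      -- the approximating activation, which is a point of the cover.
      have h4 : Matrix.toEuclideanLin (A l) (N.subnet A l (x p))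
            - Matrix.toEuclideanLin (N.ref l + Δ) (N.subnet A' l (x p))
          = Matrix.toEuclideanLin (A l) (N.subnet A l (x p) - N.subnet A' l (x p))
            + Matrix.toEuclideanLin (A l - N.ref l - Δ) (N.subnet A' l (x p)) := by
        simp only [map_sub, map_add, LinearMap.sub_apply, LinearMap.add_apply]
        abel
      rw [h4, mul_add]
      calc (N.lip l : ℝ) * ‖_ + _‖
          ≤ N.lip l * ‖Matrix.toEuclideanLin (A l) (N.subnet A l (x p) - N.subnet A' l (x p))‖
            + N.lip l * ‖Matrix.toEuclideanLin (A l - N.ref l - Δ) (N.subnet A' l (x p))‖ := by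
            rw [← mul_add]; gcongr; exact norm_add_le _ _
        _ ≤ _ := by
          refine add_le_add ?_ h3
          gcongr
          refine (norm_toEuclideanLin_le _ _).trans ?_
          have := (hA l hlL).1
          have := N.s_pos l hlL
          gcongr

lemma errBound_eq (e : ℕ → ℝ) (u : ℕ) :
    N.errBound e u = ∑ i ∈ Finset.range u,
      e i * (N.lip i * ∏ m ∈ Finset.Ico (i + 1) u, N.s m * (N.lip m : ℝ)) := by
  induction u with
  | zero => simp [errBound]
  | succ u ih =>
    rw [errBound, ih, Finset.sum_range_succ, Finset.Ico_self, Finset.prod_empty, mul_add,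
      Finset.mul_sum, Finset.mul_sum]
    congr 1
    · refine Finset.sum_congr rfl fun i hi => ?_
      rw [Finset.mem_range] at hi
      rw [Finset.prod_Ico_succ_top (by omega)]
      ring
    · ring

/-- This is the term `u - 1` of the supremum in `lipHat`, whose index is shifted by one. An error
made in the layer of index `i` thus reaches depth `u` with size relative to `b u`, uniformly in `u`.
-/
lemma lip_mul_prod_le (b : ℕ → ℝ) (hb : ∀ l ≤ L, 1 ≤ b l) {i u : ℕ} (hi : i < u) (hu : u ≤ L) :
    N.lip i * ∏ m ∈ Finset.Ico (i + 1) u, N.s m * (N.lip m : ℝ) ≤ b u * N.lipHat b i := by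
  have hbu : 0 < b u := by linarith [hb u hu]
  have h := le_ciSup (f := fun v : Set.Ico i L =>
    (b ((v : ℕ) + 1))⁻¹ * ∏ m ∈ Finset.Ioc i (v : ℕ), N.s m * (N.lip m : ℝ))
    (Set.finite_range _).bddAbove ⟨u - 1, by simp only [Set.mem_Ico]; omega⟩
  have h1 : Finset.Ioc i (u - 1) = Finset.Ico (i + 1) u := by
    ext; simp only [Finset.mem_Ioc, Finset.mem_Ico]; omega
  simp only [h1, Nat.sub_add_cancel (show 1 ≤ u by omega)] at h
  rw [inv_mul_le_iff₀ hbu] at h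
  rw [lipHat]
  calc _ ≤ (N.lip i : ℝ) * (b u * _) := by gcongr
    _ = _ := by ring

lemma lipHat_nonneg (b : ℕ → ℝ) (hb : ∀ l ≤ L, 1 ≤ b l) {i : ℕ} (hi : i < L) :
    0 ≤ N.lipHat b i := by
  have h := N.lip_mul_prod_le b hb (Nat.lt_succ_self i) hi
  have hbi : 0 < b (i + 1) := by linarith [hb (i + 1) hi]
  simp only [Nat.succ_eq_add_one, Finset.Ico_self, Finset.prod_empty, mul_one] at h
  exact nonneg_of_mul_nonneg_right ((N.lip i).coe_nonneg.trans h) hbi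

lemma lipHat_pos (b : ℕ → ℝ) (hb : ∀ l ≤ L, 1 ≤ b l) {i : ℕ} (hi : i < L) (h0 : N.lip i ≠ 0) :
    0 < N.lipHat b i := by
  have h := N.lip_mul_prod_le b hb (Nat.lt_succ_self i) hi
  have hbi : 0 < b (i + 1) := by linarith [hb (i + 1) hi]
  simp only [Nat.succ_eq_add_one, Finset.Ico_self, Finset.prod_empty, mul_one] at h
  have h1 : (0 : ℝ) < N.lip i := by positivity
  exact pos_of_mul_pos_right (h1.trans_le h) hbi.le

lemma errBound_le (b : ℕ → ℝ) (hb : ∀ l ≤ L, 1 ≤ b l) (e : ℕ → ℝ)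
    (he : ∀ i < L, 0 ≤ e i) {u : ℕ} (hu : u ≤ L) :
    N.errBound e u ≤ b u * ∑ i ∈ Finset.range L, e i * N.lipHat b i := by
  have hbu : 0 < b u := by linarith [hb u hu]
  rw [errBound_eq, Finset.mul_sum]
  calc _ ≤ ∑ i ∈ Finset.range u, b u * (e i * N.lipHat b i) := Finset.sum_le_sum fun i hi => ?_
    _ ≤ _ := Finset.sum_le_sum_of_subset_of_nonneg (Finset.range_mono hu) fun i hi _ => ?_
  · rw [Finset.mem_range] at hi
    have := N.lip_mul_prod_le b hb hi hu
    have := he i (by omega)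
    calc _ ≤ e i * (b u * N.lipHat b i) := by gcongr
      _ = _ := by ring
  · rw [Finset.mem_range] at hi
    have := N.lipHat_nonneg b hb hi
    have := he i hi
    positivity

lemma le_width {l : ℕ} (hl : l < L) : N.d (l + 1) ≤ N.width :=
  Finset.le_sup (f := fun l => N.d (l + 1)) (Finset.mem_range.2 hl)

end NetSpec
end DCRL

/-! ### The augmented loss and its stability under approximation. -/

namespace DCRL

/-- The inputs of a tuple as a family. -/
def Tuple.inp {m k : ℕ} (t : Tuple m k) : Option (Option (Fin k)) → Euc m
  | none => t.1
  | some none => t.2.1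
  | some (some i) => t.2.2 i

lemma Tuple.range_inp {m k : ℕ} (t : Tuple m k) : Set.range t.inp = t.inputs := by
  ext x
  simp only [Set.mem_range, Option.exists, Tuple.inp, Tuple.inputs, Set.mem_union,
    Set.mem_insert_iff, Set.mem_singleton_iff, or_assoc, eq_comm]

namespace NetSpec

variable {L : ℕ} (N : NetSpec L) {k : ℕ} (b : ℕ → ℝ)

/-- A continuous substitute for the indicator that some layer exceeds its threshold `b l` on
some input of the tuple: it vanishes if no threshold is exceeded, and equals `1` if some threshold
is exceeded by a factor `2`. -/
noncomputable def overshoot (A : N.Weights) (t : Tuple (N.d 0) k) : ℝ :=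
  ((Finset.univ.sup fun q : Fin L × Option (Option (Fin k)) =>
    (min 1 (‖N.subnet A (q.1 + 1) (t.inp q.2)‖ / b (q.1 + 1) - 1)).toNNReal : ℝ≥0) : ℝ)

lemma overshoot_nonneg (A : N.Weights) (t : Tuple (N.d 0) k) : 0 ≤ N.overshoot b A t :=
  NNReal.coe_nonneg _

lemma overshoot_le_one (A : N.Weights) (t : Tuple (N.d 0) k) : N.overshoot b A t ≤ 1 := by
  rw [overshoot, NNReal.coe_le_one]
  exact Finset.sup_le fun q _ => by simp

lemma overshoot_eq_zero (hb : ∀ l ≤ L, 1 ≤ b l) (A : N.Weights) (t : Tuple (N.d 0) k)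
    (h : ∀ l, 1 ≤ l → l ≤ L → ∀ x ∈ t.inputs, ‖N.subnet A l x‖ ≤ b l) :
    N.overshoot b A t = 0 := by
  rw [overshoot, NNReal.coe_eq_zero]
  refine le_antisymm (Finset.sup_le fun q _ => ?_) zero_le
  refine (Real.toNNReal_eq_zero.2 ?_).le
  refine (min_le_right _ _).trans ?_
  have h1 := h (q.1 + 1) (by omega) q.1.2 (t.inp q.2) (t.range_inp ▸ Set.mem_range_self _)
  have h2 := hb (q.1 + 1) q.1.2
  rw [sub_nonpos, div_le_one (by linarith)]
  exact h1

lemma overshoot_eq_one (hb : ∀ l ≤ L, 1 ≤ b l) (A : N.Weights) (t : Tuple (N.d 0) k) {l : ℕ}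
    (h1 : 1 ≤ l) (hl : l ≤ L) (i : Option (Option (Fin k)))
    (h : 2 * b l ≤ ‖N.subnet A l (t.inp i)‖) :
    N.overshoot b A t = 1 := by
  refine le_antisymm (N.overshoot_le_one b A t) ?_
  obtain ⟨l, rfl⟩ : ∃ l', l = l' + 1 := ⟨l - 1, by omega⟩
  have h2 := hb _ hl
  rw [overshoot]
  have h3 := Finset.le_sup (f := fun q : Fin L × Option (Option (Fin k)) =>
    (min 1 (‖N.subnet A (q.1 + 1) (t.inp q.2)‖ / b (q.1 + 1) - 1)).toNNReal)
    (Finset.mem_univ ((⟨l, hl⟩ : Fin L), i))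
  refine le_trans ?_ (NNReal.coe_le_coe.2 h3)
  refine le_trans (le_min le_rfl ?_) (Real.le_coe_toNNReal _)
  rw [le_sub_iff_add_le, le_div_iff₀ (by linarith)]
  linarith

/-- Norms enter only after division by `b l`, and the truncation and the supremum are 1-Lipschitz,
so errors are passed on in relative size. -/
lemma overshoot_le_add (hb : ∀ l ≤ L, 1 ≤ b l) (A A' : N.Weights) (t : Tuple (N.d 0) k) {ε : ℝ}
    (hε : 0 ≤ ε) (h : ∀ l ≤ L, ∀ i, ‖N.subnet A l (t.inp i)‖ ≤ ‖N.subnet A' l (t.inp i)‖ + ε * b l) :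
    N.overshoot b A t ≤ N.overshoot b A' t + ε := by
  lift ε to ℝ≥0 using hε
  rw [overshoot, overshoot, ← NNReal.coe_add, NNReal.coe_le_coe]
  refine Finset.sup_le fun q _ => ?_
  have h3 := Finset.le_sup (f := fun q : Fin L × Option (Option (Fin k)) =>
    (min 1 (‖N.subnet A' (q.1 + 1) (t.inp q.2)‖ / b (q.1 + 1) - 1)).toNNReal) (Finset.mem_univ q)
  refine le_trans ?_ (add_le_add_left h3 ε)
  rw [Real.toNNReal_le_iff_le_coe]
  push_cast
  have h4 := h _ q.1.2 q.2
  have h2 : 0 < b (q.1 + 1) := by linarith [hb _ (show (q.1 : ℕ) + 1 ≤ L from q.1.2)]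
  refine le_trans ?_ (add_le_add_left (Real.le_coe_toNNReal _) _)
  have h5 : ‖N.subnet A (q.1 + 1) (t.inp q.2)‖ / b (q.1 + 1)
      ≤ ‖N.subnet A' (q.1 + 1) (t.inp q.2)‖ / b (q.1 + 1) + ε := by
    rw [div_add' _ _ _ h2.ne']
    gcongr
  rcases min_cases (1 : ℝ) (‖N.subnet A' (q.1 + 1) (t.inp q.2)‖ / b (q.1 + 1) - 1) with h6 | h6
  · rw [h6.1]; exact (min_le_left _ _).trans (by simp)
  · rw [h6.1]; exact (min_le_right _ _).trans (by linarith)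

/-- The truncated loss, raised to its maximal value `M` where a threshold is exceeded by far. -/
noncomputable def augLoss (ℓ : (Fin k → ℝ) → ℝ) (M : ℝ) (A : N.Weights) (t : Tuple (N.d 0) k) : ℝ :=
  max (min (ℓ (margins (N.net A) t)) M) (M * N.overshoot b A t)

variable {b} {ℓ : (Fin k → ℝ) → ℝ} {M η : ℝ}

lemma augLoss_nonneg (hM : 0 < M) (A : N.Weights) (t : Tuple (N.d 0) k) :
    0 ≤ N.augLoss b ℓ M A t :=
  le_max_of_le_right (mul_nonneg hM.le (N.overshoot_nonneg b A t))

lemma augLoss_le (hM : 0 < M) (A : N.Weights) (t : Tuple (N.d 0) k) :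
    N.augLoss b ℓ M A t ≤ M :=
  max_le (min_le_right _ _) (mul_le_of_le_one_right hM.le (N.overshoot_le_one b A t))

lemma augLoss_eq_of_overshoot (A : N.Weights) (t : Tuple (N.d 0) k)
    (h : N.overshoot b A t = 1) : N.augLoss b ℓ M A t = M := by
  rw [augLoss, h, mul_one]
  exact max_eq_right (min_le_right _ _)

/-- The inner product is expanded bilinearly. As `‖f‖ ≤ 4 * B` on the inputs, the two parts give `8
* B ^ 2 * ε` and `6 * B ^ 2 * ε`. -/
lemma abs_margin_sub_le {m p q : ℕ} (f g : Euc m → Euc p) (t : Tuple m q) {B ε : ℝ}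
    (hB : 0 ≤ B) (hε : 0 ≤ ε)
    (hg : ∀ i, ‖g (t.inp i)‖ ≤ 3 * B)
    (hfg : ∀ i, ‖f (t.inp i) - g (t.inp i)‖ ≤ B * ε) (hε1 : ε ≤ 1) :
    ‖margins f t - margins g t‖ ≤ 14 * B ^ 2 * ε := by
  rw [pi_norm_le_iff_of_nonneg (by positivity)]
  intro i
  have hf : ∀ i, ‖f (t.inp i)‖ ≤ 4 * B := fun i => by
    have := norm_le_norm_add_norm_sub' (f (t.inp i)) (g (t.inp i))
    have := hg i; have := hfg i
    nlinarith
  have a1 := hfg none; have a2 := hfg (some none); have a3 := hfg (some (some i))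
  have b1 := hg none
  have c2 := hf (some none); have c3 := hf (some (some i))
  simp only [Tuple.inp] at a1 a2 a3 b1 c2 c3
  simp only [Pi.sub_apply, margins, Real.norm_eq_abs]
  set x := t.1
  set y := t.2.1
  set w := t.2.2 i
  have e : inner ℝ (f x) (f y - f w) - inner ℝ (g x) (g y - g w)
      = inner ℝ (f x - g x) (f y - f w) + inner ℝ (g x) ((f y - g y) - (f w - g w)) := by
    simp only [inner_sub_left, inner_sub_right]; ring
  rw [e]
  calc _ ≤ |inner ℝ (f x - g x) (f y - f w)| + |inner ℝ (g x) ((f y - g y) - (f w - g w))| :=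
        abs_add_le _ _
    _ ≤ ‖f x - g x‖ * ‖f y - f w‖ + ‖g x‖ * ‖(f y - g y) - (f w - g w)‖ :=
        add_le_add (abs_real_inner_le_norm _ _) (abs_real_inner_le_norm _ _)
    _ ≤ (B * ε) * (4 * B + 4 * B) + (3 * B) * (B * ε + B * ε) := by
        gcongr
        · exact (norm_sub_le _ _).trans (add_le_add c2 c3)
        · exact (norm_sub_le _ _).trans (add_le_add a2 a3)
    _ = _ := by ring

lemma abs_augLoss_sub_le (hb : ∀ l ≤ L, 1 ≤ b l) (hη : 0 ≤ η) (hM : 0 < M)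
    (hℓ : ∀ v w, |ℓ v - ℓ w| ≤ η * ‖v - w‖) (A A' : N.Weights) (t : Tuple (N.d 0) k) {ε : ℝ}
    (hε : 0 ≤ ε) (hε1 : ε ≤ 1) (hA' : ∀ i, ‖N.subnet A' L (t.inp i)‖ ≤ 3 * b L)
    (h : ∀ l ≤ L, ∀ i, ‖N.subnet A l (t.inp i) - N.subnet A' l (t.inp i)‖ ≤ b l * ε) :
    |N.augLoss b ℓ M A t - N.augLoss b ℓ M A' t| ≤ 14 * max (η * b L ^ 2) M * ε := by
  have hbL := hb L le_rfl
  refine (abs_max_sub_max_le_max _ _ _ _).trans (max_le ?_ ?_)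
  · refine (abs_min_sub_min_le_max _ _ _ _).trans (max_le ?_ (by simp; positivity))
    refine (hℓ _ _).trans ?_
    calc η * _ ≤ η * (14 * b L ^ 2 * ε) := by
          gcongr
          exact abs_margin_sub_le _ _ _ (by linarith) hε hA' (h L le_rfl) hε1
      _ = 14 * (η * b L ^ 2) * ε := by ring
      _ ≤ _ := by gcongr; exact le_max_left _ _
  · rw [← mul_sub, abs_mul, abs_of_pos hM]
    have h1 : |N.overshoot b A t - N.overshoot b A' t| ≤ ε := by
      rw [abs_sub_le_iff]
      constructor
      · have := N.overshoot_le_add b hb A A' t hε fun l hl i => by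
          have := norm_le_norm_add_norm_sub' (N.subnet A l (t.inp i)) (N.subnet A' l (t.inp i))
          have := h l hl i
          linarith
        linarith
      · have := N.overshoot_le_add b hb A' A t hε fun l hl i => by
          have := norm_le_norm_add_norm_sub (N.subnet A l (t.inp i)) (N.subnet A' l (t.inp i))
          have := h l hl i
          linarith
        linarith
    have h2 := le_max_right (η * b L ^ 2) M
    calc M * _ ≤ max (η * b L ^ 2) M * ε := by gcongr
      _ ≤ _ := by nlinarith [mul_nonneg (hM.le.trans h2) hε]

open scoped Classical in
/-- Two networks that are approximated by the same network, up to the first layer at which it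
exceeds the thresholds, have close augmented losses. -/
lemma abs_augLoss_sub_le_of_approx (hb : ∀ l ≤ L, 1 ≤ b l) (hη : 0 ≤ η) (hM : 0 < M)
    (hℓ : ∀ v w, |ℓ v - ℓ w| ≤ η * ‖v - w‖) (A A' G : N.Weights) (t : Tuple (N.d 0) k)
    (ht : ∀ i, ‖t.inp i‖ ≤ 3 * b 0) {ε : ℝ} (hε : 0 ≤ ε) (hε1 : ε ≤ 1)
    (hA : ∀ i, ∀ u ≤ L, (∀ v < u, ‖N.subnet G v (t.inp i)‖ ≤ 3 * b v) →
      ‖N.subnet A u (t.inp i) - N.subnet G u (t.inp i)‖ ≤ b u * ε)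
    (hA' : ∀ i, ∀ u ≤ L, (∀ v < u, ‖N.subnet G v (t.inp i)‖ ≤ 3 * b v) →
      ‖N.subnet A' u (t.inp i) - N.subnet G u (t.inp i)‖ ≤ b u * ε) :
    |N.augLoss b ℓ M A t - N.augLoss b ℓ M A' t| ≤ 28 * max (η * b L ^ 2) M * ε := by
  by_cases halive : ∀ i, ∀ u ≤ L, ‖N.subnet G u (t.inp i)‖ ≤ 3 * b u
  · have h1 := N.abs_augLoss_sub_le hb hη hM hℓ A G t hε hε1 (fun i => halive i L le_rfl)
      fun l hl i => hA i l hl fun v hv => halive i v (by omega)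
    have h2 := N.abs_augLoss_sub_le hb hη hM hℓ A' G t hε hε1 (fun i => halive i L le_rfl)
      fun l hl i => hA' i l hl fun v hv => halive i v (by omega)
    rw [abs_sub_comm] at h2
    have := abs_sub_le (N.augLoss b ℓ M A t) (N.augLoss b ℓ M G t) (N.augLoss b ℓ M A' t)
    linarith
  -- At the first layer `u` where `G` exceeds `3 * b u`, both networks are still within `b u * ε ≤ b
  -- u` of it. Both therefore exceed `2 * b u`, and both augmented losses equal `M`.
  · push Not at halive
    obtain ⟨i, hi⟩ := halive
    obtain ⟨hu, hu'⟩ := Nat.find_spec hi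
    set u := Nat.find hi
    have hmin : ∀ v < u, ‖N.subnet G v (t.inp i)‖ ≤ 3 * b v := fun v hv => by
      have := Nat.find_min hi hv
      push Not at this
      exact this (by omega)
    -- The overshoot only sees the layers from 1 on; the input itself respects the threshold by
    -- `ht`.
    have hu1 : 1 ≤ u := by
      by_contra! h0
      have h0 : u = 0 := by omega
      rw [h0] at hu'
      exact absurd (ht i) (not_le.2 hu')
    have hbu := hb u hu
    have key : ∀ A : N.Weights, ‖N.subnet A u (t.inp i) - N.subnet G u (t.inp i)‖ ≤ b u * ε →
        N.augLoss b ℓ M A t = M := fun A h => by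
      refine N.augLoss_eq_of_overshoot A t (N.overshoot_eq_one b hb A t hu1 hu i ?_)
      have := norm_le_norm_add_norm_sub (N.subnet A u (t.inp i)) (N.subnet G u (t.inp i))
      nlinarith
    rw [key A (hA i u hu hmin), key A' (hA' i u hu hmin)]
    have : 0 ≤ max (η * b L ^ 2) M := hM.le.trans (le_max_right _ _)
    simp only [sub_self, abs_zero]
    positivity

end NetSpec

/-- A labelling by a finite set gives a choice of representatives. -/
lemma exists_representatives {ι κ : Type*} (F : Finset κ) (lbl : ι → κ) (hlbl : ∀ a, lbl a ∈ F) :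
    ∃ rep : ι → ι, (Set.range rep).Finite ∧ (Set.range rep).ncard ≤ F.card ∧
      ∀ a, lbl (rep a) = lbl a := by
  rcases isEmpty_or_nonempty ι with h | h
  · exact ⟨id, Set.toFinite _, by simp [Set.range_eq_empty], fun a => h.elim a⟩
  have hsub : Set.range (fun a => Function.invFun lbl (lbl a))
      ⊆ Function.invFun lbl '' (F : Set κ) := by
    rintro _ ⟨a, rfl⟩
    exact ⟨_, hlbl a, rfl⟩
  have hfin := (F.finite_toSet.image (Function.invFun lbl))
  refine ⟨fun a => Function.invFun lbl (lbl a), hfin.subset hsub, ?_,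
    fun a => Function.invFun_eq ⟨a, rfl⟩⟩
  refine (Set.ncard_le_ncard hsub hfin).trans ((Set.ncard_image_le F.finite_toSet).trans ?_)
  rw [Set.ncard_coe_finset]

end DCRL

/-! ### Metric entropy of the class in terms of its complexity. -/

namespace DCRL

namespace NetSpec

variable {L : ℕ} (N : NetSpec L) {k : ℕ} {b : ℕ → ℝ} {ℓ : (Fin k → ℝ) → ℝ} {M η : ℝ}

open scoped Classical in
/-- The covering of the class of networks at a given accuracy, in terms of its complexity. -/
lemma exists_cover_of_complexity_le {P : Type*} [Fintype P] (x : P → Euc (N.d 0))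
    (hb : ∀ l ≤ L, 1 ≤ b l) {r ε : ℝ} (hr : 0 < r) (hrb : N.complexity b ≤ r) (hε : 0 < ε) :
    ∃ F : Finset N.Weights,
      F.card ≤ (1 + N.width * Fintype.card P * (⌊36 * r ^ 2 / ε ^ 2⌋₊ + 1)) ^
        ⌊36 * r ^ 2 / ε ^ 2⌋₊ ∧
      ∀ A ∈ N.params, ∃ A' ∈ F, ∀ p, ∀ u ≤ L, (∀ v < u, ‖N.subnet A' v (x p)‖ ≤ 3 * b v) →
        ‖N.subnet A u (x p) - N.subnet A' u (x p)‖ ≤ b u * ε := by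
  set m := ⌊36 * r ^ 2 / ε ^ 2⌋₊ with hm
  set ρ : ℝ := r ^ (2 / 3 : ℝ) with hρ_def
  have hρ : 0 < ρ := Real.rpow_pos_of_pos hr _
  have hρ3 : ρ ^ 3 = r ^ 2 := by
    rw [hρ_def, ← Real.rpow_natCast, ← Real.rpow_mul hr.le, ← Real.rpow_natCast]
    norm_num
  let w : ℕ → ℝ := fun i => N.a i * b i * N.lipHat b i
  have hw : ∀ i < L, 0 ≤ w i := fun i hi =>
    mul_nonneg (mul_nonneg (N.a_pos i hi).le (by linarith [hb i hi.le])) (N.lipHat_nonneg b hb hi)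
  let y : ℕ → ℝ := fun i => w i ^ (2 / 3 : ℝ)
  have hy : ∀ i < L, 0 ≤ y i := fun i hi => Real.rpow_nonneg (hw i hi) _
  have hy3 : ∀ i < L, y i ^ 3 = w i ^ 2 := fun i hi => by
    simp only [y]
    rw [← Real.rpow_natCast, ← Real.rpow_mul (hw i hi), ← Real.rpow_natCast]
    norm_num
  have hS0 : 0 ≤ ∑ i ∈ Finset.range L, y i :=
    Finset.sum_nonneg fun i hi => hy i (Finset.mem_range.1 hi)
  have hS : ∑ i ∈ Finset.range L, y i ≤ ρ := by
    have h1 : ((∑ i ∈ Finset.range L, y i) ^ (3 / 2 : ℝ)) ^ (2 / 3 : ℝ) ≤ ρ :=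
      Real.rpow_le_rpow (Real.rpow_nonneg hS0 _) hrb (by norm_num)
    rw [← Real.rpow_mul hS0] at h1
    norm_num at h1
    exact h1
  have hyρ : ∀ i < L, y i ≤ ρ := fun i hi =>
    (Finset.single_le_sum (fun j hj => hy j (Finset.mem_range.1 hj)) (Finset.mem_range.2 hi)).trans
      hS
  let T : ℕ → ℝ := fun i => 36 * y i * ρ ^ 2 / ε ^ 2
  have hT0 : ∀ i < L, 0 ≤ T i := fun i hi => by
    have := hy i hi
    simp only [T]; positivity
  have hT : ∀ i < L, T i ≤ 36 * r ^ 2 / ε ^ 2 := fun i hi => by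
    simp only [T]
    rw [← hρ3]
    have := hyρ i hi
    have : y i * ρ ^ 2 ≤ ρ * ρ ^ 2 := by gcongr
    refine div_le_div_of_nonneg_right ?_ (by positivity)
    linarith
  -- The accuracy is split in proportion to `y i = w i ^ (2 / 3)`, so that the propagated errors sum
  -- to at most `ε` and the layer entropies `T i` to at most `36 * ρ ^ 3 / ε ^ 2`. A layer with
  -- Lipschitz constant zero has `lipHat = 0` and commits no error.
  let e : ℕ → ℝ := fun i => if N.lip i = 0 then 0 else ε * y i / (N.lipHat b i * ρ)
  have he : ∀ i < L, 0 ≤ e i := fun i hi => by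
    have := hy i hi; have := N.lipHat_nonneg b hb hi
    simp only [e]
    split_ifs
    · exact le_rfl
    · positivity
  set G := 1 + N.width * Fintype.card P * (m + 1) with hG
  obtain ⟨F, hF, hcov⟩ := N.exists_weights_cover x (fun l => 3 * b l)
    (fun l hl => by linarith [hb l hl]) e (fun i => G ^ ⌊T i⌋₊) (by
      intro i hi z hz
      by_cases h0 : N.lip i = 0
      · exact ⟨{0}, by simpa using Nat.one_le_pow _ _ (by omega), fun Δ _ =>
          ⟨0, by simp, fun p => by simp [h0]⟩⟩
      have hl := N.lipHat_pos b hb hi h0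
      have hai := N.a_pos i hi
      have hbi : 0 < b i := by linarith [hb i hi.le]
      have hwi : 0 < w i := by positivity
      have hyi : 0 < y i := Real.rpow_pos_of_pos hwi _
      have hei : e i = ε * y i / (N.lipHat b i * ρ) := if_neg h0
      have hei0 : 0 < e i := by rw [hei]; positivity
      obtain ⟨F, hF, hcov⟩ := exists_matrix_cover (p := N.d (i + 1)) hai
        (show 0 < 3 * b i by positivity) hei0 z hz
      -- The factor 36 is `4 * 3 ^ 2`; the identity `y i ^ 3 = w i ^ 2` leaves a single power of `y
      -- i`, which can be summed over the layers.
      have hTi : 4 * N.a i ^ 2 * (3 * b i) ^ 2 / e i ^ 2 = T i := by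
        have h3 : y i ^ 3 = (N.a i * b i * N.lipHat b i) ^ 2 := hy3 i hi
        simp only [T]
        rw [hei]
        field_simp
        rw [h3]; ring
      have hTi4 : N.a i ^ 2 * (3 * b i) ^ 2 / e i ^ 2 = T i / 4 := by rw [← hTi]; ring
      rw [hTi, hTi4] at hF
      refine ⟨F, hF.trans ?_, fun Δ hΔ => ?_⟩
      · have h1 : 2 * ⌊T i / 4⌋₊ ≤ m := by
          refine Nat.le_floor ?_
          have := Nat.floor_le (show 0 ≤ T i / 4 by linarith [hT0 i hi])
          have := hT i hi
          have := hT0 i hi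
          push_cast
          linarith
        have := N.le_width hi
        simp only [hG]
        gcongr
      · obtain ⟨Δ', h1, h2⟩ := hcov Δ hΔ
        exact ⟨Δ', h1, fun p => by gcongr; exact h2 p⟩) L le_rfl
  refine ⟨F, hF.trans ?_, fun A hA => ?_⟩
  · rw [Finset.prod_pow_eq_pow_sum]
    refine Nat.pow_le_pow_right (by omega) (Nat.le_floor ?_)
    push_cast
    calc ∑ i ∈ Finset.range L, (⌊T i⌋₊ : ℝ) ≤ ∑ i ∈ Finset.range L, T i :=
          Finset.sum_le_sum fun i hi => Nat.floor_le (hT0 i (Finset.mem_range.1 hi))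
      _ = 36 * (∑ i ∈ Finset.range L, y i) * ρ ^ 2 / ε ^ 2 := by
          simp only [T]
          rw [← Finset.sum_div, ← Finset.sum_mul, ← Finset.mul_sum]
      _ ≤ 36 * ρ * ρ ^ 2 / ε ^ 2 := by gcongr
      _ = 36 * r ^ 2 / ε ^ 2 := by rw [← hρ3]; ring
  · obtain ⟨A', hA', h⟩ := hcov A hA
    refine ⟨A', hA', fun p u hu halive => (h p u hu halive).trans ?_⟩
    refine (N.errBound_le b hb e he hu).trans ?_
    have hbu : 0 ≤ b u := by linarith [hb u hu]
    gcongr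
    calc ∑ i ∈ Finset.range L, e i * N.lipHat b i
        ≤ ∑ i ∈ Finset.range L, ε * y i / ρ := by
          refine Finset.sum_le_sum fun i hi => ?_
          have hi := Finset.mem_range.1 hi
          have hyi := hy i hi
          by_cases h0 : N.lip i = 0
          · simp only [e, if_pos h0, zero_mul]; positivity
          · have := N.lipHat_pos b hb hi h0
            simp only [e, if_neg h0]
            apply le_of_eq
            field_simp
      _ = ε * (∑ i ∈ Finset.range L, y i) / ρ := by
          rw [← Finset.sum_div, ← Finset.mul_sum]
      _ ≤ ε * ρ / ρ := by gcongr
      _ = ε := by field_simp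

/-- The covering of the augmented losses on finitely many tuples, by members of the class. -/
lemma exists_augLoss_cover {J : Type*} [Fintype J] (t : J → Tuple (N.d 0) k)
    (ht : ∀ j i, ‖(t j).inp i‖ ≤ 3 * b 0) (hb : ∀ l ≤ L, 1 ≤ b l) (hη : 0 ≤ η) (hM : 0 < M)
    (hℓ : ∀ v w, |ℓ v - ℓ w| ≤ η * ‖v - w‖) {r ε : ℝ} (hr : 0 < r) (hrb : N.complexity b ≤ r)
    (hε : 0 < ε) :
    ∃ rep : N.params → N.params, (Set.range rep).Finite ∧
      (Set.range rep).ncard ≤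
        (1 + N.width * (Fintype.card J * (k + 2)) * (⌊36 * r ^ 2 / ε ^ 2⌋₊ + 1)) ^
          ⌊36 * r ^ 2 / ε ^ 2⌋₊ ∧
      ∀ (A : N.params) (j : J), |N.augLoss b ℓ M A (t j) - N.augLoss b ℓ M (rep A) (t j)|
        ≤ 28 * max (η * b L ^ 2) M * ε := by
  have hβ : M ≤ max (η * b L ^ 2) M := le_max_right _ _
  rcases le_or_gt ε 1 with hε1 | hε1
  · obtain ⟨F, hF, hcov⟩ := N.exists_cover_of_complexity_le
      (fun q : J × Option (Option (Fin k)) => (t q.1).inp q.2) hb hr hrb hε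
    choose lbl hlbl happ using fun A : N.params => hcov A A.2
    obtain ⟨rep, hfin, hcard, hrep⟩ := exists_representatives F lbl hlbl
    refine ⟨rep, hfin, hcard.trans ?_, fun A j => ?_⟩
    · simpa [Fintype.card_prod, Fintype.card_option] using hF
    · refine N.abs_augLoss_sub_le_of_approx hb hη hM hℓ A (rep A) (lbl A) (t j) (ht j) hε.le hε1
        (fun i => happ A (j, i)) (fun i => ?_)
      rw [← hrep A]
      exact happ (rep A) (j, i)
  -- Above accuracy 1 a single representative suffices, since the augmented losses lie in `[0, M]`.
  · obtain ⟨rep, hfin, hcard, -⟩ := exists_representatives (ι := N.params) {()} (fun _ => ())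
      (by simp)
    refine ⟨rep, hfin, hcard.trans ?_, fun A j => ?_⟩
    · simpa using Nat.one_le_pow _ _ (by omega)
    · have h1 := N.augLoss_nonneg (b := b) (ℓ := ℓ) hM A (t j)
      have h2 := N.augLoss_nonneg (b := b) (ℓ := ℓ) hM (rep A) (t j)
      have h3 := N.augLoss_le (b := b) (ℓ := ℓ) hM A (t j)
      have h4 := N.augLoss_le (b := b) (ℓ := ℓ) hM (rep A) (t j)
      rw [abs_le]
      constructor <;> nlinarith

end NetSpec
end DCRL

namespace DCRL

/-! ### Sign averages, Massart's lemma and chaining. -/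

section Rademacher

variable {J : Type*} [Fintype J]

/-- The real number `1` or `-1`. -/
def sgn (s : Bool) : ℝ := if s then 1 else -1

/-- The signed sum of the coordinates of a vector. -/
noncomputable def signedSum (σ : J → Bool) (v : J → ℝ) : ℝ := ∑ j, sgn (σ j) * v j

lemma abs_sgn (s : Bool) : |sgn s| = 1 := by cases s <;> simp [sgn]

lemma signedSum_le {v : J → ℝ} {e : ℝ} (h : ∀ j, |v j| ≤ e) (σ : J → Bool) :
    signedSum σ v ≤ Fintype.card J * e := by
  calc signedSum σ v ≤ ∑ _j : J, e := Finset.sum_le_sum fun j _ => by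
        refine (le_abs_self _).trans ?_
        rw [abs_mul, abs_sgn, one_mul]; exact h j
    _ = _ := by simp

variable [DecidableEq J]

/-- The expectation with respect to independent uniform signs. -/
noncomputable def signAvg (f : (J → Bool) → ℝ) : ℝ := (∑ σ, f σ) / 2 ^ Fintype.card J

lemma signAvg_mono {f g : (J → Bool) → ℝ} (h : ∀ σ, f σ ≤ g σ) : signAvg f ≤ signAvg g := by
  unfold signAvg
  gcongr
  exact h _

lemma signAvg_add (f g : (J → Bool) → ℝ) :
    signAvg (fun σ => f σ + g σ) = signAvg f + signAvg g := by
  simp only [signAvg, Finset.sum_add_distrib, add_div]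

lemma signAvg_sum {κ : Type*} (s : Finset κ) (f : κ → (J → Bool) → ℝ) :
    signAvg (fun σ => ∑ i ∈ s, f i σ) = ∑ i ∈ s, signAvg (f i) := by
  simp only [signAvg]
  rw [Finset.sum_comm, Finset.sum_div]

lemma signAvg_const (c : ℝ) : signAvg (fun _ : J → Bool => c) = c := by
  simp [signAvg]

lemma exp_mul_signAvg_le (f : (J → Bool) → ℝ) (t : ℝ) :
    Real.exp (t * signAvg f) ≤ signAvg fun σ => Real.exp (t * f σ) := by
  have h := convexOn_exp.map_sum_le (t := (Finset.univ : Finset (J → Bool)))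
    (w := fun _ => (1 / 2 ^ Fintype.card J : ℝ)) (p := fun σ => t * f σ)
    (fun _ _ => by positivity) (by simp) (fun _ _ => Set.mem_univ _)
  simp only [smul_eq_mul, ← Finset.mul_sum] at h
  calc _ = Real.exp (1 / 2 ^ Fintype.card J * (t * ∑ σ, f σ)) := by
        unfold signAvg; congr 1; ring
    _ ≤ _ := h
    _ = _ := by unfold signAvg; ring

lemma signAvg_exp_signedSum (v : J → ℝ) :
    signAvg (fun σ => Real.exp (signedSum σ v)) = ∏ j, Real.cosh (v j) := by
  have h : ∀ j, Real.cosh (v j) = (∑ s : Bool, Real.exp (sgn s * v j)) / 2 := fun j => by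
    simp [Real.cosh_eq, sgn]
  simp only [h, Finset.prod_div_distrib, Finset.prod_const, Finset.card_univ, signAvg, signedSum,
    Real.exp_sum]
  rw [Finset.prod_univ_sum, Fintype.piFinset_univ]

lemma signAvg_signedSum (v : J → ℝ) : signAvg (fun σ => signedSum σ v) = 0 := by
  simp only [signAvg, div_eq_zero_iff]
  left
  have h : ∑ σ : J → Bool, signedSum σ v = ∑ σ : J → Bool, signedSum (fun j => !(σ j)) v :=
    (Equiv.sum_comp (Equiv.piCongrRight fun _ => Equiv.boolNot) fun σ => signedSum σ v).symm
  have h2 : ∀ σ : J → Bool, signedSum (fun j => !(σ j)) v = -signedSum σ v := fun σ => by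
    simp only [signedSum, ← Finset.sum_neg_distrib]
    refine Finset.sum_congr rfl fun j _ => ?_
    cases σ j <;> simp [sgn]
  simp only [h2, Finset.sum_neg_distrib] at h
  linarith

/-- Optimization of the exponential-moment bound at `t = √(2 * c) / R`. The degenerate cases `R = 0`
and `c = 0` have no optimal `t` and need other choices. -/
lemma le_mul_sqrt_of_forall_pos {x c R : ℝ} (hc : 0 ≤ c) (hR : 0 ≤ R)
    (h : ∀ t > 0, x ≤ c / t + t * R ^ 2 / 2) : x ≤ R * √(2 * c) := by
  by_contra! hx
  have hx0 : 0 < x := lt_of_le_of_lt (by positivity) hx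
  rcases hR.eq_or_lt with rfl | hR
  · have := h (c / x + 1) (by positivity)
    have h2 : c / (c / x + 1) < x := by
      rw [div_lt_iff₀ (by positivity)]
      field_simp
      linarith
    simp at this
    linarith
  rcases hc.eq_or_lt with rfl | hc
  · have := h (x / R ^ 2) (by positivity)
    field_simp at this
    nlinarith
  have hs : 0 < √(2 * c) := by positivity
  have h1 := h (√(2 * c) / R) (by positivity)
  have h2 : c / (√(2 * c) / R) + √(2 * c) / R * R ^ 2 / 2 = R * √(2 * c) := by
    have h3 : √(2 * c) ^ 2 = 2 * c := Real.sq_sqrt (by positivity)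
    field_simp
    rw [mul_comm c 2, h3]; ring
  linarith

/-- Massart's lemma. -/
lemma exists_signAvg_le_of_finite {V : Set (J → ℝ)} (hV : V.Finite) (hne : V.Nonempty) {c : ℕ}
    (hc : V.ncard ≤ c) {R : ℝ} (hR : 0 ≤ R) (hVR : ∀ v ∈ V, ∑ j, v j ^ 2 ≤ R ^ 2) :
    ∃ f : (J → Bool) → ℝ, (∀ v ∈ V, ∀ σ, signedSum σ v ≤ f σ) ∧
      signAvg f ≤ R * √(2 * Real.log c) := by
  lift V to Finset (J → ℝ) using hV
  rw [Set.ncard_coe_finset] at hc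
  have hne : V.Nonempty := by simpa using hne
  have hc1 : 1 ≤ c := hne.card_pos.trans_le hc
  refine ⟨fun σ => V.sup' hne fun v => signedSum σ v, fun v hv σ =>
    Finset.le_sup' (fun v => signedSum σ v) hv, ?_⟩
  refine le_mul_sqrt_of_forall_pos (Real.log_nonneg (by exact_mod_cast hc1)) hR fun t ht => ?_
  have key : Real.exp (t * signAvg fun σ => V.sup' hne fun v => signedSum σ v)
      ≤ c * Real.exp (t ^ 2 * R ^ 2 / 2) := by
    refine (exp_mul_signAvg_le _ _).trans ?_
    calc _ ≤ signAvg fun σ : J → Bool => ∑ v ∈ V, Real.exp (signedSum σ (t • v)) := by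
          refine signAvg_mono fun σ => ?_
          obtain ⟨v, hv, h⟩ := Finset.exists_mem_eq_sup' hne fun v => signedSum σ v
          rw [h]
          have h2 : t * signedSum σ v = signedSum σ (t • v) := by
            simp only [signedSum, Finset.mul_sum, Pi.smul_apply, smul_eq_mul]
            exact Finset.sum_congr rfl fun j _ => by ring
          rw [h2]
          exact Finset.single_le_sum (f := fun v => Real.exp (signedSum σ (t • v)))
            (fun _ _ => (Real.exp_pos _).le) hv
      _ = ∑ v ∈ V, ∏ j, Real.cosh (t * v j) := by
          rw [signAvg_sum]
          exact Finset.sum_congr rfl fun v _ => signAvg_exp_signedSum _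
      _ ≤ ∑ v ∈ V, Real.exp (t ^ 2 * R ^ 2 / 2) := by
          refine Finset.sum_le_sum fun v hv => ?_
          calc ∏ j, Real.cosh (t * v j) ≤ ∏ j, Real.exp ((t * v j) ^ 2 / 2) :=
                Finset.prod_le_prod (fun j _ => (Real.cosh_pos _).le)
                  fun j _ => Real.cosh_le_exp_half_sq _
            _ = Real.exp (t ^ 2 * (∑ j, v j ^ 2) / 2) := by
                rw [← Real.exp_sum, Finset.mul_sum, Finset.sum_div]
                simp only [mul_pow]
            _ ≤ _ := by
                have := hVR v hv
                gcongr
      _ ≤ c * Real.exp (t ^ 2 * R ^ 2 / 2) := by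
          rw [Finset.sum_const, nsmul_eq_mul]
          gcongr
  have h2 := Real.log_le_log (Real.exp_pos _) key
  rw [Real.log_exp, Real.log_mul (by positivity) (Real.exp_pos _).ne', Real.log_exp] at h2
  rw [← sub_nonneg]
  have h3 : 0 ≤ (Real.log c + t ^ 2 * R ^ 2 / 2
      - t * signAvg fun σ => V.sup' hne fun v => signedSum σ v) / t :=
    div_nonneg (by linarith) ht.le
  refine h3.trans_eq ?_
  field_simp

/-- Chaining along finitely many scales. -/
lemma exists_signAvg_le_of_nets {ι : Type*} [Nonempty ι] (v : ι → J → ℝ) (K : ℕ)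
    (rep : ℕ → ι → ι) (c : ℕ → ℕ) (e : ℕ → ℝ) (he : ∀ i, 0 ≤ e i)
    (hfin : ∀ i, (Set.range (rep i)).Finite) (hcard : ∀ i, (Set.range (rep i)).ncard ≤ c i)
    (hrep : ∀ i a j, |v a j - v (rep i a) j| ≤ e i) (hK : c K = 1) :
    ∃ f : (J → Bool) → ℝ, (∀ a σ, signedSum σ (v a) ≤ f σ) ∧
      signAvg f ≤ Fintype.card J * e 0 + ∑ i ∈ Finset.range K,
        √(Fintype.card J) * (e i + e (i + 1)) * √(2 * Real.log (c i * c (i + 1))) := by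
  -- The links of the chain: differences of representatives at consecutive scales, at most `c i * c
  -- (i + 1)` many, of Euclidean norm at most `√(card J) * (e i + e (i + 1))`.
  let V : ℕ → Set (J → ℝ) := fun i => Set.range fun a => v (rep i a) - v (rep (i + 1) a)
  have hsub : ∀ i, V i ⊆ (fun q : ι × ι => v q.1 - v q.2) ''
      (Set.range (rep i) ×ˢ Set.range (rep (i + 1))) := by
    rintro i _ ⟨a, rfl⟩
    exact ⟨(rep i a, rep (i + 1) a), ⟨⟨a, rfl⟩, ⟨a, rfl⟩⟩, rfl⟩
  have hfin2 : ∀ i, (Set.range (rep i) ×ˢ Set.range (rep (i + 1))).Finite :=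
    fun i => (hfin i).prod (hfin (i + 1))
  have key : ∀ i, ∃ f : (J → Bool) → ℝ, (∀ v ∈ V i, ∀ σ, signedSum σ v ≤ f σ) ∧
      signAvg f ≤ √(Fintype.card J) * (e i + e (i + 1)) * √(2 * Real.log (c i * c (i + 1))) := by
    intro i
    have h := exists_signAvg_le_of_finite (V := V i) (((hfin2 i).image _).subset (hsub i))
      (Set.range_nonempty _) (c := c i * c (i + 1)) ?_ (R := √(Fintype.card J) * (e i + e (i + 1)))
      (mul_nonneg (Real.sqrt_nonneg _) (add_nonneg (he _) (he _))) ?_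
    · simpa using h
    · refine (Set.ncard_le_ncard (hsub i) ((hfin2 i).image _)).trans ?_
      refine (Set.ncard_image_le (hfin2 i)).trans ?_
      rw [Set.ncard_prod]
      exact Nat.mul_le_mul (hcard _) (hcard _)
    · rintro _ ⟨a, rfl⟩
      rw [mul_pow, Real.sq_sqrt (Nat.cast_nonneg _), ← nsmul_eq_mul, ← Finset.card_univ,
        ← Finset.sum_const]
      refine Finset.sum_le_sum fun j _ => ?_
      rw [← sq_abs]
      gcongr
      have h1 := hrep i a j
      have h2 := hrep (i + 1) a j
      rw [abs_sub_comm] at h1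
      calc _ ≤ |v (rep i a) j - v a j| + |v a j - v (rep (i + 1) a) j| := abs_sub_le _ _ _
        _ ≤ _ := add_le_add h1 h2
  choose f hf1 hf2 using key
  obtain ⟨a₀⟩ := ‹Nonempty ι›
  -- The coarsest net is a single point. Its signed sum is common to all chains and has average
  -- zero.
  have hKc : ∀ a, rep K a = rep K a₀ := fun a => by
    have := (Set.ncard_le_one (hfin K)).1 ((hcard K).trans hK.le)
    exact this _ ⟨a, rfl⟩ _ ⟨a₀, rfl⟩
  refine ⟨fun σ => (Fintype.card J * e 0 + ∑ i ∈ Finset.range K, f i σ)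
    + signedSum σ (v (rep K a₀)), fun a σ => ?_, ?_⟩
  · have hadd : ∀ w w' : J → ℝ, signedSum σ w = signedSum σ (w - w') + signedSum σ w' :=
      fun w w' => by
        simp only [signedSum, ← Finset.sum_add_distrib, Pi.sub_apply]
        exact Finset.sum_congr rfl fun j _ => by ring
    have tele : ∀ m, signedSum σ (v (rep 0 a))
        ≤ (∑ i ∈ Finset.range m, f i σ) + signedSum σ (v (rep m a)) := by
      intro m
      induction m with
      | zero => simp
      | succ m ih =>
        rw [Finset.sum_range_succ]
        have h1 := hadd (v (rep m a)) (v (rep (m + 1) a))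
        have h2 := hf1 m _ ⟨a, rfl⟩ σ
        simp only at h2
        linarith
    have h1 := tele K
    rw [hKc a] at h1
    have h2 := hadd (v a) (v (rep 0 a))
    have h3 := signedSum_le (v := v a - v (rep 0 a)) (fun j => hrep 0 a j) σ
    linarith
  · rw [signAvg_add, signAvg_add, signAvg_const, signAvg_sum, signAvg_signedSum, add_zero]
    gcongr with i hi
    exact hf2 i

/-- Chaining along dyadic scales, when the metric entropy at scale `e * 2 ^ i` is at most
`36 * card J / 4 ^ i`, up to a logarithmic factor. -/
lemma exists_signAvg_le_of_dyadic_nets {ι : Type*} [Nonempty ι] (v : ι → J → ℝ) {K : ℕ}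
    (hK : 36 * Fintype.card J < 4 ^ K) {G : ℕ} (hG : 1 ≤ G) {e : ℝ} (he : 0 ≤ e)
    (hnet : ∀ i : ℕ, ∃ rep : ι → ι, (Set.range rep).Finite ∧
      (Set.range rep).ncard ≤ G ^ ⌊36 * (Fintype.card J : ℝ) / 4 ^ i⌋₊ ∧
      ∀ a j, |v a j - v (rep a) j| ≤ e * 2 ^ i) :
    ∃ f : (J → Bool) → ℝ, (∀ a σ, signedSum σ (v a) ≤ f σ) ∧
      signAvg f ≤ Fintype.card J * e * (1 + 36 * K * √(Real.log G)) := by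
  choose rep hfin hcard hrep using hnet
  set n : ℝ := ((Fintype.card J : ℕ) : ℝ)
  have hn : 0 ≤ n := Nat.cast_nonneg _
  obtain ⟨f, hf1, hf2⟩ := exists_signAvg_le_of_nets v K rep _ (fun i => e * 2 ^ i)
    (fun i => by positivity) hfin hcard hrep (by
      -- At scale `K` the entropy bound is below 1, so its integer part vanishes and the net has one
      -- element.
      rw [Nat.floor_eq_zero.2, pow_zero]
      rw [div_lt_one (by positivity)]
      simp only [n]
      exact_mod_cast hK)
  refine ⟨f, hf1, hf2.trans ?_⟩
  have hlog : 0 ≤ Real.log G := Real.log_nonneg (by exact_mod_cast hG)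
  have hterm : ∀ i ∈ Finset.range K, √n * (e * 2 ^ i + e * 2 ^ (i + 1)) *
      √(2 * Real.log (((G ^ ⌊36 * n / 4 ^ i⌋₊ : ℕ) : ℝ) * ((G ^ ⌊36 * n / 4 ^ (i + 1)⌋₊ : ℕ) : ℝ)))
      ≤ n * e * (36 * √(Real.log G)) := by
    intro i _
    -- The two entropies add up to at most `72 * n / 4 ^ i`, whence the root of `144 * n / 4 ^ i`.
    -- The factor `2 ^ i` cancels against the link length `3 * e * 2 ^ i`, so every scale
    -- contributes `36 * n * e * √(log G)`.
    have h1 : √(2 * Real.log (((G ^ ⌊36 * n / 4 ^ i⌋₊ : ℕ) : ℝ)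
          * ((G ^ ⌊36 * n / 4 ^ (i + 1)⌋₊ : ℕ) : ℝ)))
        ≤ 12 * √n / 2 ^ i * √(Real.log G) := by
      apply Real.sqrt_le_iff.2
      refine ⟨by positivity, ?_⟩
      push_cast
      rw [← pow_add, Real.log_pow, mul_pow, div_pow, mul_pow, Real.sq_sqrt hn, Real.sq_sqrt hlog,
        ← pow_mul, mul_comm i 2, pow_mul]
      have h2 := Nat.floor_le (show 0 ≤ 36 * n / 4 ^ i by positivity)
      have h3 := Nat.floor_le (show 0 ≤ 36 * n / 4 ^ (i + 1) by positivity)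
      have h4 : 36 * n / 4 ^ (i + 1) ≤ 36 * n / 4 ^ i := by
        gcongr <;> norm_num
      push_cast
      calc 2 * (((⌊36 * n / 4 ^ i⌋₊ : ℝ) + ⌊36 * n / 4 ^ (i + 1)⌋₊) * Real.log G)
          ≤ 2 * ((36 * n / 4 ^ i + 36 * n / 4 ^ i) * Real.log G) := by
            gcongr
            exact h3.trans h4
        _ = _ := by norm_num; ring
    calc _ ≤ √n * (e * 2 ^ i + e * 2 ^ (i + 1)) * (12 * √n / 2 ^ i * √(Real.log G)) := by gcongr
      _ = (√n * √n) * e * (36 * √(Real.log G)) := by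
          rw [pow_succ]; field_simp; ring
      _ = _ := by rw [Real.mul_self_sqrt hn]
  calc _ ≤ n * (e * 2 ^ 0) + ∑ i ∈ Finset.range K, n * e * (36 * √(Real.log G)) :=
        add_le_add le_rfl (Finset.sum_le_sum hterm)
    _ = _ := by
        rw [Finset.sum_const, Finset.card_range, nsmul_eq_mul]; ring

end Rademacher
end DCRL

namespace DCRL

/-! ### McDiarmid's inequality. -/

section Concentration

variable {Ω : Type*} [MeasurableSpace Ω] (μ : Measure Ω) [IsProbabilityMeasure μ]

lemma integrable_of_abs_le {Ω' : Type*} [MeasurableSpace Ω'] {ν : Measure Ω'} [IsFiniteMeasure ν]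
    {f : Ω' → ℝ} (hf : Measurable f) {C : ℝ} (hC : ∀ x, |f x| ≤ C) : Integrable f ν :=
  Integrable.of_bound hf.aestronglyMeasurable C (ae_of_all _ hC)

/-- Hoeffding's lemma for a random variable of bounded oscillation. -/
lemma integral_exp_le_of_oscillation {g : Ω → ℝ} (hg : Measurable g) {C c : ℝ}
    (hC : ∀ x, |g x| ≤ C) (hc : ∀ x y, g x ≤ g y + c) (t : ℝ) :
    ∫ x, Real.exp (t * g x) ∂μ ≤ Real.exp (t * ∫ x, g x ∂μ + t ^ 2 * c ^ 2 / 8) := by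
  have hΩ : Nonempty Ω := nonempty_of_isProbabilityMeasure μ
  have hc0 : 0 ≤ c := by
    obtain ⟨x⟩ := hΩ
    linarith [hc x x]
  have hbdd : BddBelow (Set.range g) := ⟨-C, by rintro _ ⟨x, rfl⟩; exact (abs_le.1 (hC x)).1⟩
  -- Oscillation at most `c` places the values in the interval of length `c` starting at the
  -- infimum.
  have h := (ProbabilityTheory.hasSubgaussianMGF_of_mem_Icc (μ := μ) hg.aemeasurable
    (a := ⨅ x, g x) (b := (⨅ x, g x) + c) (ae_of_all _ fun x =>
      ⟨ciInf_le hbdd x, by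
        rw [← sub_le_iff_le_add]
        exact le_ciInf fun y => by linarith [hc x y]⟩)).mgf_le t
  simp only [ProbabilityTheory.mgf, add_sub_cancel_left, mul_sub, Real.exp_sub, integral_div] at h
  rw [div_le_iff₀ (Real.exp_pos _), ← Real.exp_add] at h
  refine h.trans_eq ?_
  congr 1
  push_cast
  rw [Real.norm_of_nonneg hc0]
  ring

/-- The moment generating function in McDiarmid's inequality. -/
lemma integral_exp_le_of_bounded_differences {n : ℕ} {f : (Fin n → Ω) → ℝ} (hf : Measurable f)
    {C c : ℝ} (hC : ∀ S, |f S| ≤ C) (hc : ∀ S i x, f (Function.update S i x) ≤ f S + c) (t : ℝ) :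
    ∫ S, Real.exp (t * f S) ∂(Measure.pi fun _ => μ)
      ≤ Real.exp (t * ∫ S, f S ∂(Measure.pi fun _ => μ) + n * (t ^ 2 * c ^ 2 / 8)) := by
  induction n with
  | zero =>
    rw [Measure.pi_of_empty, integral_dirac, integral_dirac]
    simp
  | succ n ih =>
    let e := MeasurableEquiv.piFinSuccAbove (fun _ : Fin (n + 1) => Ω) 0
    have he : MeasurePreserving e (Measure.pi fun _ => μ) (μ.prod (Measure.pi fun _ => μ)) :=
      measurePreserving_piFinSuccAbove (fun _ : Fin (n + 1) => μ) 0
    have hes : ∀ x S, e.symm (x, S) = Fin.cons x S := fun x S => by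
      simp only [e, MeasurableEquiv.piFinSuccAbove]
      exact Fin.insertNth_zero' x S
    let F : Ω × (Fin n → Ω) → ℝ := fun p => f (e.symm p)
    have hF : Measurable F := hf.comp e.symm.measurable
    have hFC : ∀ p, |F p| ≤ C := fun p => hC _
    have htrans : ∀ φ : ℝ → ℝ, ∫ S, φ (f S) ∂(Measure.pi fun _ => μ)
        = ∫ p, φ (F p) ∂(μ.prod (Measure.pi fun _ => μ)) := fun φ => by
      rw [← he.integral_comp e.measurableEmbedding]
      simp [F]
    -- Conditional mean given the first coordinate. It inherits oscillation `c`, and the induction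
    -- hypothesis applies to the section at each `x`.
    let g : Ω → ℝ := fun x => ∫ S, F (x, S) ∂(Measure.pi fun _ => μ)
    have hFint : ∀ x, Integrable (fun S => F (x, S)) (Measure.pi fun _ => μ) := fun x =>
      integrable_of_abs_le (hF.comp measurable_prodMk_left) fun _ => hFC _
    have hg : Measurable g := (hF.stronglyMeasurable.integral_prod_right').measurable
    have hgC : ∀ x, |g x| ≤ C := fun x => by
      have := norm_integral_le_of_norm_le_const (μ := Measure.pi fun _ : Fin n => μ)
        (f := fun S => F (x, S)) (ae_of_all _ fun S => hFC (x, S))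
      simpa using this
    have hgc : ∀ x y, g x ≤ g y + c := fun x y => by
      have h1 : g y + c = ∫ S, (F (y, S) + c) ∂(Measure.pi fun _ => μ) := by
        rw [integral_add (hFint y) (integrable_const _)]; simp [g]
      rw [h1]
      refine integral_mono (hFint x) ((hFint y).add (integrable_const _)) fun S => ?_
      have := hc (Fin.cons y S) 0 x
      simpa only [F, hes, Fin.update_cons_zero] using this
    have hexpC : ∀ z, |z| ≤ C → |Real.exp (t * z)| ≤ Real.exp (|t| * C) := fun z hz => by
      rw [abs_of_pos (Real.exp_pos _), Real.exp_le_exp]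
      calc t * z ≤ |t * z| := le_abs_self _
        _ = |t| * |z| := abs_mul _ _
        _ ≤ _ := by gcongr
    have hstep : ∀ x, ∫ S, Real.exp (t * F (x, S)) ∂(Measure.pi fun _ => μ)
        ≤ Real.exp (t * g x) * Real.exp (n * (t ^ 2 * c ^ 2 / 8)) := fun x => by
      rw [← Real.exp_add]
      refine ih (hF.comp measurable_prodMk_left) (fun S => hFC (x, S)) fun S i y => ?_
      have := hc (Fin.cons x S) i.succ y
      simpa only [F, hes, Fin.cons_update] using this
    rw [htrans fun z => Real.exp (t * z), htrans fun z => z,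
      integral_prod _ (integrable_of_abs_le (by fun_prop) fun p => hexpC _ (hFC p)),
      integral_prod _ (integrable_of_abs_le hF hFC)]
    calc _ ≤ ∫ x, Real.exp (t * g x) * Real.exp (n * (t ^ 2 * c ^ 2 / 8)) ∂μ := by
          refine integral_mono ?_ ((integrable_of_abs_le (by fun_prop)
            fun x => hexpC _ (hgC x)).mul_const _) hstep
          exact (integrable_of_abs_le (ν := μ.prod (Measure.pi fun _ : Fin n => μ))
            (f := fun p => Real.exp (t * F p)) (by fun_prop)
            fun p => hexpC _ (hFC p)).integral_prod_left
      _ ≤ Real.exp (t * ∫ x, g x ∂μ + t ^ 2 * c ^ 2 / 8) * Real.exp (n * (t ^ 2 * c ^ 2 / 8)) := by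
          rw [integral_mul_const]
          gcongr
          exact integral_exp_le_of_oscillation μ hg hgC hgc t
      _ = _ := by
          rw [← Real.exp_add]
          congr 1
          push_cast
          ring

/-- McDiarmid's inequality. -/
lemma measure_le_of_bounded_differences {n : ℕ} {f : (Fin n → Ω) → ℝ}
    (hf : Measurable f) {C c : ℝ} (hC : ∀ S, |f S| ≤ C)
    (hc : ∀ S i x, f (Function.update S i x) ≤ f S + c) {s : ℝ} (hs : 0 ≤ s) :
    (Measure.pi fun _ => μ) {S | ∫ S, f S ∂(Measure.pi fun _ => μ) + s ≤ f S}
      ≤ ENNReal.ofReal (Real.exp (-s ^ 2 / (n * c ^ 2 / 2))) := by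
  set m := ∫ S, f S ∂(Measure.pi fun _ => μ)
  have hsub : ProbabilityTheory.HasSubgaussianMGF (fun S => f S - m)
      (Real.toNNReal (n * (c ^ 2 / 4))) (Measure.pi fun _ => μ) := by
    constructor
    · intro t
      refine integrable_of_abs_le (by fun_prop) (C := Real.exp (|t| * (C + |m|))) fun S => ?_
      rw [abs_of_pos (Real.exp_pos _), Real.exp_le_exp]
      calc t * (f S - m) ≤ |t * (f S - m)| := le_abs_self _
        _ = |t| * |f S - m| := abs_mul _ _
        _ ≤ _ := by
          gcongr
          exact (abs_sub _ _).trans (add_le_add (hC S) le_rfl)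
    · intro t
      simp only [ProbabilityTheory.mgf, mul_sub, Real.exp_sub, integral_div]
      rw [div_le_iff₀ (Real.exp_pos _), ← Real.exp_add]
      refine (integral_exp_le_of_bounded_differences μ hf hC hc t).trans_eq ?_
      rw [Real.coe_toNNReal _ (by positivity)]
      congr 1
      ring
  have h := hsub.measure_ge_le hs
  rw [Real.coe_toNNReal _ (by positivity), show 2 * ((n : ℝ) * (c ^ 2 / 4)) = n * c ^ 2 / 2 by ring]
    at h
  have hset : {S | m + s ≤ f S} = {S | s ≤ f S - m} := by
    ext S; simp only [Set.mem_ofPred_eq, le_sub_iff_add_le']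
  rw [hset, ← ofReal_measureReal]
  exact ENNReal.ofReal_le_ofReal h

end Concentration

/-! ### Symmetrization with a ghost sample. -/

section Symmetrization

variable {Ω : Type*} [MeasurableSpace Ω] (μ : Measure Ω) [IsProbabilityMeasure μ]
variable {ι : Type*}

lemma abs_deviation_le {n : ℕ} {g : Ω → ℝ} (hmeas : Measurable g) {M : ℝ}
    (h0 : ∀ x, 0 ≤ g x) (hM : ∀ x, g x ≤ M) (S : Fin n → Ω) :
    |n * ∫ x, g x ∂μ - ∑ j, g (S j)| ≤ n * M := by
  have hint : Integrable g μ :=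
    integrable_of_abs_le hmeas (C := M) fun x => by rw [abs_of_nonneg (h0 x)]; exact hM x
  have i0 : 0 ≤ ∫ x, g x ∂μ := integral_nonneg h0
  have i1 : ∫ x, g x ∂μ ≤ M := by
    have := integral_mono hint (integrable_const M) hM
    simpa using this
  have s0 : 0 ≤ ∑ j, g (S j) := Finset.sum_nonneg fun j _ => h0 _
  have s1 : ∑ j, g (S j) ≤ n * M := by
    calc _ ≤ ∑ _j : Fin n, M := Finset.sum_le_sum fun j _ => hM _
      _ = _ := by simp
  have : (n : ℝ) * ∫ x, g x ∂μ ≤ n * M := by gcongr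
  have : 0 ≤ (n : ℝ) * ∫ x, g x ∂μ := by positivity
  rw [abs_le]; constructor <;> linarith

lemma bddAbove_deviation {n : ℕ} {h : ι → Ω → ℝ} (hmeas : ∀ a, Measurable (h a)) {M : ℝ}
    (h0 : ∀ a x, 0 ≤ h a x) (hM : ∀ a x, h a x ≤ M) (S : Fin n → Ω) :
    BddAbove (Set.range fun a => n * ∫ x, h a x ∂μ - ∑ j, h a (S j)) :=
  ⟨n * M, by
    rintro _ ⟨a, rfl⟩
    exact (abs_le.1 (abs_deviation_le μ (hmeas a) (h0 a) (hM a) S)).2⟩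

variable [Nonempty ι]

lemma abs_iSup_deviation_le {n : ℕ} {h : ι → Ω → ℝ} (hmeas : ∀ a, Measurable (h a)) {M : ℝ}
    (h0 : ∀ a x, 0 ≤ h a x) (hM : ∀ a x, h a x ≤ M) (S : Fin n → Ω) :
    |⨆ a, (n * ∫ x, h a x ∂μ - ∑ j, h a (S j))| ≤ n * M := by
  have hdev := fun a => abs_le.1 (abs_deviation_le μ (hmeas a) (h0 a) (hM a) S)
  obtain ⟨a⟩ := ‹Nonempty ι›
  exact abs_le.2 ⟨(hdev a).1.trans (le_ciSup (bddAbove_deviation μ hmeas h0 hM S) a),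
    ciSup_le fun a => (hdev a).2⟩

variable [Countable ι]

/-- Symmetrization: the expected largest deviation of sums over a sample from their expectation
is bounded by a bound for the sign averages. -/
lemma integral_iSup_deviation_le {n : ℕ} {h : ι → Ω → ℝ} (hmeas : ∀ a, Measurable (h a)) {M : ℝ}
    (h0 : ∀ a x, 0 ≤ h a x) (hM : ∀ a x, h a x ≤ M) {p : Ω → Prop} (hp : ∀ᵐ x ∂μ, p x) {Q : ℝ}
    (hQ : ∀ Z : Fin n → Ω × Ω, (∀ j, p (Z j).1 ∧ p (Z j).2) →
      ∃ f : (Fin n → Bool) → ℝ,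
        (∀ a σ, signedSum σ (fun j => h a (Z j).1 - h a (Z j).2) ≤ f σ) ∧ signAvg f ≤ Q) :
    ∫ S, ⨆ a, (n * ∫ x, h a x ∂μ - ∑ j, h a (S j)) ∂(Measure.pi fun _ : Fin n => μ) ≤ Q := by
  have hint : ∀ a, Integrable (h a) μ := fun a =>
    integrable_of_abs_le (hmeas a) (C := M) fun x => by rw [abs_of_nonneg (h0 a x)]; exact hM a x
  have hdiff : ∀ a x y, |h a x - h a y| ≤ M := fun a x y => by
    rw [abs_le]; constructor <;> linarith [h0 a x, h0 a y, hM a x, hM a y]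
  have hM0 : 0 ≤ M := by
    obtain ⟨a⟩ := ‹Nonempty ι›
    obtain ⟨x⟩ := nonempty_of_isProbabilityMeasure μ
    exact (h0 a x).trans (hM a x)
  have hsum : ∀ (σ : Fin n → Bool) (a : ι) (Z : Fin n → Ω × Ω),
      |signedSum σ (fun j => h a (Z j).1 - h a (Z j).2)| ≤ n * M := fun σ a Z => by
    rw [abs_le]
    constructor
    · have := signedSum_le (v := fun j => -(h a (Z j).1 - h a (Z j).2)) (e := M)
        (fun j => by rw [abs_neg]; exact hdiff _ _ _) σ
      simp only [signedSum, mul_neg, Finset.sum_neg_distrib, Fintype.card_fin] at this ⊢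
      linarith
    · have := signedSum_le (v := fun j => (h a (Z j).1 - h a (Z j).2)) (e := M)
        (fun j => hdiff _ _ _) σ
      simpa using this
  let Ψ : (Fin n → Bool) → (Fin n → Ω × Ω) → ℝ := fun σ Z =>
    ⨆ a, signedSum σ (fun j => h a (Z j).1 - h a (Z j).2)
  have hbdd : ∀ (σ : Fin n → Bool) (Z : Fin n → Ω × Ω), BddAbove (Set.range fun a =>
      signedSum σ (fun j => h a (Z j).1 - h a (Z j).2)) := fun σ Z =>
    ⟨n * M, by rintro _ ⟨a, rfl⟩; exact (abs_le.1 (hsum σ a Z)).2⟩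
  have hΨmeas : ∀ σ, Measurable (Ψ σ) := fun σ => by
    refine Measurable.iSup fun a => ?_
    unfold signedSum
    have := hmeas a
    fun_prop
  have hΨC : ∀ σ Z, |Ψ σ Z| ≤ n * M := fun σ Z => by
    rw [abs_le]
    obtain ⟨a⟩ := ‹Nonempty ι›
    exact ⟨(abs_le.1 (hsum σ a Z)).1.trans (le_ciSup (hbdd σ Z) a),
      ciSup_le fun a => (abs_le.1 (hsum σ a Z)).2⟩
  let ν : Measure (Fin n → Ω × Ω) := Measure.pi fun _ => μ.prod μ
  have hΨint : ∀ σ, Integrable (Ψ σ) ν := fun σ => integrable_of_abs_le (hΨmeas σ) (hΨC σ)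
  -- the integral does not depend on the signs
  have hinv : ∀ σ, ∫ Z, Ψ σ Z ∂ν = ∫ Z, Ψ (fun _ => true) Z ∂ν := fun σ => by
    -- Exchanging the two members of the `j`-th pair preserves the law and flips the `j`-th sign.
    have hsw : MeasurePreserving (fun (Z : Fin n → Ω × Ω) j =>
        (if σ j then id else Prod.swap : Ω × Ω → Ω × Ω) (Z j)) ν ν :=
      measurePreserving_pi _ _ fun j => by
        split_ifs
        · exact MeasurePreserving.id _
        · exact Measure.measurePreserving_swap
    rw [← hsw.map_eq, integral_map hsw.measurable.aemeasurable (hΨmeas _).aestronglyMeasurable,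
      hsw.map_eq]
    refine integral_congr_ae (ae_of_all _ fun Z => ?_)
    refine iSup_congr fun a => Finset.sum_congr rfl fun j _ => ?_
    by_cases hσ : σ j = true <;> simp [sgn, hσ]
  have hbound : ∫ Z, Ψ (fun _ => true) Z ∂ν ≤ Q := by
    have h1 : ∫ Z, Ψ (fun _ => true) Z ∂ν = ∫ Z, signAvg (fun σ => Ψ σ Z) ∂ν := by
      simp only [signAvg]
      rw [integral_div, integral_finsetSum _ fun σ _ => hΨint σ]
      simp only [hinv, Finset.sum_const, Finset.card_univ, nsmul_eq_mul]
      simp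
    rw [h1]
    have hae : ∀ᵐ Z ∂ν, ∀ j, p (Z j).1 ∧ p (Z j).2 := by
      rw [ae_all_iff]
      intro j
      have h2 : ∀ᵐ z ∂(μ.prod μ), p z.1 ∧ p z.2 :=
        (Measure.quasiMeasurePreserving_fst.ae hp).and (Measure.quasiMeasurePreserving_snd.ae hp)
      exact (measurePreserving_eval (fun _ : Fin n => μ.prod μ) j).quasiMeasurePreserving.ae h2
    calc ∫ Z, signAvg (fun σ => Ψ σ Z) ∂ν ≤ ∫ Z, Q ∂ν := by
          refine integral_mono_ae ?_ (integrable_const _) ?_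
          · simp only [signAvg]
            exact (integrable_finsetSum _ fun σ _ => hΨint σ).div_const _
          · filter_upwards [hae] with Z hZ
            obtain ⟨f, hf1, hf2⟩ := hQ Z hZ
            exact (signAvg_mono fun σ => ciSup_le fun a => hf1 a σ).trans hf2
      _ = Q := by simp
  refine le_trans ?_ hbound
  -- Jensen's inequality for the supremum
  let e := MeasurableEquiv.arrowProdEquivProdArrow Ω Ω (Fin n)
  have he : MeasurePreserving e ν
      ((Measure.pi fun _ => μ).prod (Measure.pi fun _ => μ)) :=
    measurePreserving_arrowProdEquivProdArrow Ω Ω (Fin n) (fun _ => μ) (fun _ => μ)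
  let Φ : (Fin n → Ω) → (Fin n → Ω) → ℝ := fun S' S => ⨆ a, ∑ j, (h a (S' j) - h a (S j))
  have hΦΨ : ∀ Z, Φ (e Z).1 (e Z).2 = Ψ (fun _ => true) Z := fun Z => by
    simp [Φ, Ψ, signedSum, sgn, e, MeasurableEquiv.arrowProdEquivProdArrow,
      Equiv.arrowProdEquivProdArrow]
  have hΦ' : ∀ q : (Fin n → Ω) × (Fin n → Ω), Φ q.1 q.2 = Ψ (fun _ => true) (e.symm q) := fun q => by
    rw [← hΦΨ, e.apply_symm_apply]
  have hΦmeas : Measurable fun q : (Fin n → Ω) × (Fin n → Ω) => Φ q.1 q.2 := by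
    simp only [hΦ']
    exact (hΨmeas _).comp e.symm.measurable
  have hΦC : ∀ S' S, |Φ S' S| ≤ n * M := fun S' S => by
    rw [hΦ' (S', S)]; exact hΨC _ _
  rw [← integral_congr_ae (ae_of_all _ hΦΨ)]
  rw [he.integral_comp e.measurableEmbedding (fun q => Φ q.1 q.2),
    integral_prod_symm _ (integrable_of_abs_le hΦmeas fun q => hΦC _ _)]
  have hbdd2 : ∀ S' S : Fin n → Ω, BddAbove (Set.range fun a => ∑ j, (h a (S' j) - h a (S j))) :=
    fun S' S => ⟨∑ _j : Fin n, M, by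
      rintro _ ⟨a, rfl⟩
      exact Finset.sum_le_sum fun j _ => (abs_le.1 (hdiff a _ _)).2⟩
  have hle : ∀ S, ⨆ a, (n * ∫ x, h a x ∂μ - ∑ j, h a (S j))
      ≤ ∫ S', Φ S' S ∂(Measure.pi fun _ => μ) := fun S => by
    refine ciSup_le fun a => ?_
    have hIj : ∀ j : Fin n, Integrable (fun S' : Fin n → Ω => h a (S' j))
        (Measure.pi fun _ => μ) := fun j =>
      integrable_of_abs_le ((hmeas a).comp (measurable_pi_apply j)) (C := M)
        fun x => by rw [abs_of_nonneg (h0 a _)]; exact hM a _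
    have h1 : n * ∫ x, h a x ∂μ - ∑ j, h a (S j)
        = ∫ S', ∑ j, (h a (S' j) - h a (S j)) ∂(Measure.pi fun _ => μ) := by
      rw [integral_finsetSum (f := fun j (S' : Fin n → Ω) => h a (S' j) - h a (S j)) _
        fun j _ => (hIj j).sub (integrable_const _)]
      have h2 : ∀ j : Fin n, ∫ S', (h a (S' j) - h a (S j)) ∂(Measure.pi fun _ => μ)
          = ∫ x, h a x ∂μ - h a (S j) := fun j => by
        rw [integral_sub (hIj j) (integrable_const _)]
        have h3 := (measurePreserving_eval (fun _ : Fin n => μ) j)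
        have h4 : ∫ S', h a (S' j) ∂(Measure.pi fun _ => μ) = ∫ x, h a x ∂μ := by
          conv_rhs => rw [← h3.map_eq]
          rw [integral_map h3.measurable.aemeasurable (hmeas a).aestronglyMeasurable]
        rw [h4]; simp
      simp only [h2, Finset.sum_sub_distrib, Finset.sum_const, Finset.card_univ, Fintype.card_fin,
        nsmul_eq_mul]
    rw [h1]
    exact integral_mono (integrable_finsetSum _ fun j _ => (hIj j).sub (integrable_const _))
      (integrable_of_abs_le (hΦmeas.comp measurable_prodMk_right) fun S' => hΦC S' S)
      fun S' => le_ciSup (hbdd2 S' S) a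
  refine integral_mono (integrable_of_abs_le (C := n * M) ?_ fun S => ?_)
    (integrable_of_abs_le (ν := (Measure.pi fun _ : Fin n => μ).prod (Measure.pi fun _ => μ))
      hΦmeas fun q => hΦC _ _).integral_prod_right hle
  · refine Measurable.iSup fun a => ?_
    have := hmeas a
    fun_prop
  · exact abs_iSup_deviation_le μ hmeas h0 hM S

end Symmetrization
end DCRL

namespace DCRL

/-! ### The law of tuples as a mixture over classes. -/

section Mixtures

lemma tsum_prod_pi {α : Type*} {k : ℕ} (f : Fin k → α → ℝ≥0∞) :
    ∑' z : Fin k → α, ∏ i, f i (z i) = ∏ i, ∑' a, f i a := by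
  induction k with
  | zero => simp
  | succ k ih =>
    rw [← (Fin.consEquiv fun _ : Fin (k + 1) => α).tsum_eq, ENNReal.tsum_prod']
    simp only [Fin.consEquiv_apply, Fin.prod_univ_succ, Fin.cons_zero, Fin.cons_succ,
      ENNReal.tsum_mul_left, ih fun i => f i.succ, ENNReal.tsum_mul_right]

/-- Passing to finite partial sums avoids any countability of the index set; this is why the
comparison of mixtures below is an inequality. -/
lemma tsum_lintegral_le {α ι : Type*} [MeasurableSpace α] {μ : Measure α} {f : ι → α → ℝ≥0∞}
    (hf : ∀ i, Measurable (f i)) : ∑' i, ∫⁻ x, f i x ∂μ ≤ ∫⁻ x, ∑' i, f i x ∂μ := by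
  rw [ENNReal.tsum_eq_iSup_sum]
  refine iSup_le fun s => ?_
  rw [← lintegral_finsetSum _ fun i _ => hf i]
  exact lintegral_mono fun x => ENNReal.sum_le_tsum s

variable {𝒞 : Type*} (prior : PMF 𝒞) {m : ℕ} (D : 𝒞 → Measure (Euc m))

/-- The total prior weight of the classes other than `c`. -/
noncomputable def negMass (c : 𝒞) : ℝ≥0∞ := ∑' z : {z : 𝒞 // z ≠ c}, prior z

lemma negMass_add (c : 𝒞) : prior c + negMass prior c = 1 := by
  have h := ENNReal.summable.tsum_add_tsum_compl (f := prior) (s := {c}) ENNReal.summable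
  rw [prior.tsum_coe, tsum_singleton] at h
  exact h

lemma negMass_ne_top (c : 𝒞) : negMass prior c ≠ ∞ := fun h => by
  have := negMass_add prior c
  rw [h] at this
  simp at this

lemma negMass_toReal (c : 𝒞) : (negMass prior c).toReal = 1 - (prior c).toReal := by
  have := congrArg ENNReal.toReal (negMass_add prior c)
  rw [ENNReal.toReal_add (prior.apply_ne_top c) (negMass_ne_top prior c)] at this
  simp at this
  linarith

lemma negMass_ne_zero {c z : 𝒞} (hz : z ≠ c) (h : prior z ≠ 0) : negMass prior c ≠ 0 := fun h0 =>
  h (ENNReal.tsum_eq_zero.1 h0 ⟨z, hz⟩)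

variable [∀ c, IsProbabilityMeasure (D c)]

lemma isProbabilityMeasure_negLaw {c : 𝒞} (h : negMass prior c ≠ 0) :
    IsProbabilityMeasure (negLaw prior D c) := by
  constructor
  rw [negLaw, Measure.smul_apply, Measure.sum_apply _ MeasurableSet.univ]
  simp only [Measure.smul_apply, measure_univ, smul_eq_mul, mul_one]
  exact ENNReal.inv_mul_cancel h (negMass_ne_top prior c)

/-- A product of mixtures is the mixture of the products. It suffices to compare both sides on
boxes, where this is distributivity. -/
lemma pi_negLaw {c : 𝒞} (h : negMass prior c ≠ 0) (k : ℕ) :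
    Measure.pi (fun _ : Fin k => negLaw prior D c) =
      Measure.sum fun z : Fin k → {z : 𝒞 // z ≠ c} =>
        (∏ i, ((negMass prior c)⁻¹ * prior (z i))) • Measure.pi fun i => D (z i) := by
  have := isProbabilityMeasure_negLaw prior D h
  refine Measure.pi_eq fun s hs => ?_
  rw [Measure.sum_apply _ (MeasurableSet.univ_pi hs)]
  simp only [Measure.smul_apply, Measure.pi_pi, smul_eq_mul, ← Finset.prod_mul_distrib]
  rw [tsum_prod_pi fun i (z : {z : 𝒞 // z ≠ c}) => (negMass prior c)⁻¹ * prior z * D z (s i)]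
  refine Finset.prod_congr rfl fun i _ => ?_
  rw [negLaw, Measure.smul_apply, Measure.sum_apply _ (hs i)]
  simp only [Measure.smul_apply, smul_eq_mul, mul_assoc, ENNReal.tsum_mul_left]
  rfl

lemma isProbabilityMeasure_tupleLaw (h : ∀ c, negMass prior c ≠ 0) (k : ℕ) :
    IsProbabilityMeasure (tupleLaw prior D k) := by
  have := fun c => isProbabilityMeasure_negLaw prior D (h c)
  constructor
  rw [tupleLaw, Measure.sum_apply _ MeasurableSet.univ]
  simp [prior.tsum_coe]

lemma ae_tupleLaw_inp (h : ∀ c, negMass prior c ≠ 0) (k : ℕ) {B : Set (Euc m)}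
    (hB : MeasurableSet B) (hDB : ∀ c, ∀ᵐ x ∂(D c), x ∈ B) :
    ∀ᵐ t ∂(tupleLaw prior D k), ∀ i, t.inp i ∈ B := by
  have := fun c => isProbabilityMeasure_negLaw prior D (h c)
  have hneg : ∀ c, ∀ᵐ x ∂(negLaw prior D c), x ∈ B := fun c => by
    have : (Measure.sum fun z : {z : 𝒞 // z ≠ c} => prior z • D z) Bᶜ = 0 := by
      rw [Measure.sum_apply _ hB.compl, ENNReal.tsum_eq_zero]
      intro z
      have : D z Bᶜ = 0 := hDB z
      rw [Measure.smul_apply, this, smul_zero]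
    rw [ae_iff, negLaw, Measure.smul_apply]
    have h2 : {a | a ∉ B} = Bᶜ := rfl
    rw [h2, this, smul_zero]
  have hmeas : MeasurableSet {t : Tuple m k | ∀ i, t.inp i ∈ B} := by
    have : {t : Tuple m k | ∀ i, t.inp i ∈ B}
        = ⋂ i, (fun t : Tuple m k => t.inp i) ⁻¹' B := by ext; simp
    rw [this]
    refine MeasurableSet.iInter fun i => ?_
    rcases i with _ | _ | i
    · exact hB.preimage measurable_fst
    · exact hB.preimage (measurable_fst.comp measurable_snd)
    · exact hB.preimage ((measurable_pi_apply i).comp (measurable_snd.comp measurable_snd))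
  rw [ae_iff]
  have h2 : {t : Tuple m k | ¬ ∀ i, t.inp i ∈ B} = {t : Tuple m k | ∀ i, t.inp i ∈ B}ᶜ := rfl
  rw [h2, tupleLaw, Measure.sum_apply _ hmeas.compl, ENNReal.tsum_eq_zero]
  intro c
  have h3 : ∀ᵐ t ∂((D c).prod ((D c).prod (Measure.pi fun _ : Fin k => negLaw prior D c))),
      ∀ i, Tuple.inp t i ∈ B := by
    have e1 := Measure.quasiMeasurePreserving_fst (μ := D c)
      (ν := (D c).prod (Measure.pi fun _ : Fin k => negLaw prior D c))
    have e2 := Measure.quasiMeasurePreserving_snd (μ := D c)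
      (ν := (D c).prod (Measure.pi fun _ : Fin k => negLaw prior D c))
    have e3 := Measure.quasiMeasurePreserving_fst (μ := D c)
      (ν := Measure.pi fun _ : Fin k => negLaw prior D c)
    have e4 := Measure.quasiMeasurePreserving_snd (μ := D c)
      (ν := Measure.pi fun _ : Fin k => negLaw prior D c)
    rw [ae_all_iff]
    rintro (_ | _ | i)
    · exact e1.ae (hDB c)
    · exact e2.ae (e3.ae (hDB c))
    · exact e2.ae (e4.ae ((measurePreserving_eval (fun _ : Fin k => negLaw prior D c)
        i).quasiMeasurePreserving.ae (hneg c)))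
  rw [Measure.smul_apply]
  rw [show ((D c).prod ((D c).prod (Measure.pi fun _ : Fin k => negLaw prior D c)))
    {t : Tuple m k | ∀ i, t.inp i ∈ B}ᶜ = 0 from h3, smul_zero]

/-- The law of a tuple with given classes for the anchor and the negative samples. -/
noncomputable def classTupleLaw {k : ℕ} (c : 𝒞) (z : Fin k → 𝒞) : Measure (Tuple m k) :=
  (D c).prod ((D c).prod (Measure.pi fun i => D (z i)))

instance {k : ℕ} (c : 𝒞) (z : Fin k → 𝒞) : IsProbabilityMeasure (classTupleLaw D c z) := by
  unfold classTupleLaw; infer_instance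

/-- Conditioning on the classes of the anchor and the negative samples. Collisions among the
negative classes are included here; tasks form a sub-family. -/
lemma tsum_lintegral_classTupleLaw_le (h : ∀ c, negMass prior c ≠ 0) {k : ℕ}
    {F : Tuple m k → ℝ≥0∞} (hF : Measurable F) :
    ∑' q : (c : 𝒞) × (Fin k → {z : 𝒞 // z ≠ c}),
      (prior q.1 * ∏ i, ((negMass prior q.1)⁻¹ * prior (q.2 i))) *
        ∫⁻ t, F t ∂(classTupleLaw D q.1 fun i => q.2 i) ≤ ∫⁻ t, F t ∂(tupleLaw prior D k) := by
  have := fun c => isProbabilityMeasure_negLaw prior D (h c)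
  rw [tupleLaw, lintegral_sum_measure, ENNReal.tsum_sigma']
  refine ENNReal.tsum_le_tsum fun c => ?_
  simp only [mul_assoc]
  rw [ENNReal.tsum_mul_left, lintegral_smul_measure, smul_eq_mul]
  gcongr
  simp only [classTupleLaw]
  rw [lintegral_prod _ hF.aemeasurable]
  have hF1 : ∀ x, Measurable fun y : Euc m × (Fin k → Euc m) => F (x, y) :=
    fun x => hF.comp measurable_prodMk_left
  have hF2 : ∀ x y, Measurable fun w : Fin k → Euc m => F (x, y, w) :=
    fun x y => (hF1 x).comp measurable_prodMk_left
  have step : ∀ z : Fin k → {z : 𝒞 // z ≠ c}, ∫⁻ t, F t ∂((D c).prod ((D c).prod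
        (Measure.pi fun i => D (z i)))) = ∫⁻ x, ∫⁻ y, ∫⁻ w, F (x, y, w)
          ∂(Measure.pi fun i => D (z i)) ∂(D c) ∂(D c) := fun z => by
    rw [lintegral_prod _ hF.aemeasurable]
    refine lintegral_congr fun x => ?_
    rw [lintegral_prod _ (hF1 x).aemeasurable]
  have hm1 : ∀ z : Fin k → {z : 𝒞 // z ≠ c}, Measurable fun q : Euc m × Euc m =>
      ∫⁻ w, F (q.1, q.2, w) ∂(Measure.pi fun i => D (z i)) := fun z => by
    have : Measurable fun q : (Euc m × Euc m) × (Fin k → Euc m) => F (q.1.1, q.1.2, q.2) := by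
      fun_prop
    exact this.lintegral_prod_right'
  simp only [step]
  calc ∑' z : Fin k → {z : 𝒞 // z ≠ c}, (∏ i, ((negMass prior c)⁻¹ * prior (z i))) *
        ∫⁻ x, ∫⁻ y, ∫⁻ w, F (x, y, w) ∂(Measure.pi fun i => D (z i)) ∂(D c) ∂(D c)
      = ∑' z : Fin k → {z : 𝒞 // z ≠ c}, ∫⁻ x, ∫⁻ y, (∏ i, ((negMass prior c)⁻¹ * prior (z i))) *
        ∫⁻ w, F (x, y, w) ∂(Measure.pi fun i => D (z i)) ∂(D c) ∂(D c) := by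
        refine tsum_congr fun z => ?_
        rw [← lintegral_const_mul _ (hm1 z).lintegral_prod_right']
        refine lintegral_congr fun x => ?_
        exact (lintegral_const_mul _ ((hm1 z).comp measurable_prodMk_left)).symm
    _ ≤ ∫⁻ x, ∑' z : Fin k → {z : 𝒞 // z ≠ c}, ∫⁻ y, (∏ i, ((negMass prior c)⁻¹ * prior (z i))) *
        ∫⁻ w, F (x, y, w) ∂(Measure.pi fun i => D (z i)) ∂(D c) ∂(D c) :=
        tsum_lintegral_le fun z => ((hm1 z).const_mul _).lintegral_prod_right'
    _ ≤ ∫⁻ x, ∫⁻ y, ∑' z : Fin k → {z : 𝒞 // z ≠ c}, (∏ i, ((negMass prior c)⁻¹ * prior (z i))) *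
        ∫⁻ w, F (x, y, w) ∂(Measure.pi fun i => D (z i)) ∂(D c) ∂(D c) :=
        lintegral_mono fun x => tsum_lintegral_le fun z =>
          ((hm1 z).comp measurable_prodMk_left).const_mul _
    _ = _ := by
        refine lintegral_congr fun x => ?_
        rw [lintegral_prod _ (hF1 x).aemeasurable]
        refine lintegral_congr fun y => ?_
        rw [pi_negLaw prior D (h c), lintegral_sum_measure]
        simp only [lintegral_smul_measure, smul_eq_mul]

/-- The sampling of unsupervised tuples produces the classes of a task with the `j`-th of them as
anchor; tasks are thereby tested on a part of the population of tuples. -/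
lemma tsum_task_lintegral_le (h : ∀ c, negMass prior c ≠ 0) {k : ℕ}
    {F : Tuple m k → ℝ≥0∞} (hF : Measurable F) (j : Fin (k + 1)) :
    ∑' T : Fin (k + 1) ↪ 𝒞,
      (prior (T j) * ∏ i, ((negMass prior (T j))⁻¹ * prior (T (j.succAbove i)))) *
        ∫⁻ t, F t ∂(classTupleLaw D (T j) fun i => T (j.succAbove i))
      ≤ ∫⁻ t, F t ∂(tupleLaw prior D k) := by
  refine le_trans ?_ (tsum_lintegral_classTupleLaw_le prior D h hF)
  let φ : (Fin (k + 1) ↪ 𝒞) → (c : 𝒞) × (Fin k → {z : 𝒞 // z ≠ c}) := fun T =>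
    ⟨T j, fun i => ⟨T (j.succAbove i), fun he => Fin.succAbove_ne j i (T.injective he)⟩⟩
  let ψ : ((c : 𝒞) × (Fin k → {z : 𝒞 // z ≠ c})) → 𝒞 × (Fin k → 𝒞) := fun q =>
    (q.1, fun i => q.2 i)
  -- A task is recovered from its `j`-th class and the ordered list of the others, so no outcome is
  -- counted twice.
  have hφ : Function.Injective φ := fun T T' hT => by
    have h1 := congrArg ψ hT
    simp only [ψ, φ, Prod.mk.injEq] at h1
    ext i
    rcases Fin.eq_self_or_eq_succAbove j i with rfl | ⟨i, rfl⟩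
    · exact h1.1
    · exact congrFun h1.2 i
  exact ENNReal.tsum_comp_le_tsum_of_injective hφ fun q =>
    (prior q.1 * ∏ i, ((negMass prior q.1)⁻¹ * prior (q.2 i))) *
        ∫⁻ t, F t ∂(classTupleLaw D q.1 fun i => q.2 i)

end Mixtures
end DCRL

/-! ### Jensen's inequality for the mean classifier. -/

namespace DCRL

/-- Jensen's inequality for integrals needs a closed convex set, whereas the loss is only assumed
convex on the convex hull of the margins. -/
lemma _root_.ConvexOn.closure_of_continuous {E : Type*} [NormedAddCommGroup E] [NormedSpace ℝ E]
    {s : Set E} {g : E → ℝ} (hg : ConvexOn ℝ s g) (hc : Continuous g) :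
    ConvexOn ℝ (closure s) g := by
  refine ⟨hg.1.closure, fun x hx y hy a b ha hb hab => ?_⟩
  have hclosed : IsClosed {q : E × E | g (a • q.1 + b • q.2) ≤ a • g q.1 + b • g q.2} :=
    isClosed_le (by fun_prop) (by fun_prop)
  have hsub : closure (s ×ˢ s) ⊆ {q : E × E | g (a • q.1 + b • q.2) ≤ a • g q.1 + b • g q.2} :=
    closure_minimal (fun q hq => hg.2 hq.1 hq.2 ha hb hab) hclosed
  rw [closure_prod_eq] at hsub
  exact hsub (show (x, y) ∈ _ from ⟨hx, hy⟩)

/-- Without integrability the Bochner integral is zero by convention, so the supervised risk can be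
bounded with no measurability argument. -/
lemma ofReal_integral_le_lintegral {α : Type*} [MeasurableSpace α] {μ : Measure α} {f : α → ℝ}
    (hf : ∀ x, 0 ≤ f x) : ENNReal.ofReal (∫ x, f x ∂μ) ≤ ∫⁻ x, ENNReal.ofReal (f x) ∂μ := by
  by_cases h : Integrable f μ
  · exact (ofReal_integral_eq_lintegral_ofReal h (ae_of_all _ hf)).le
  · simp [integral_undef h]

section Jensen

variable {m p k : ℕ}

lemma margins_continuous {f : Euc m → Euc p} (hf : Continuous f) :
    Continuous fun t : Tuple m k => margins f t := by
  unfold margins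
  fun_prop

variable {X : Set (Euc m)} {f : Euc m → Euc p} {C : ℝ} {V : Set (Fin k → ℝ)}
  {ℓ : (Fin k → ℝ) → ℝ}

/-- Jensen's inequality for the loss of the mean classifier. -/
lemma loss_mean_le (hf : Continuous f) (hfC : ∀ x ∈ X, ‖f x‖ ≤ C)
    (hV : ∀ t : Tuple m k, t.inputs ⊆ X → margins f t ∈ V)
    (hℓc : Continuous ℓ) (hconv : ConvexOn ℝ (convexHull ℝ V) ℓ)
    {h : Tuple m k → ℝ} (hmeas : Measurable h) {M : ℝ} (h0 : ∀ t, 0 ≤ h t) (hM : ∀ t, h t ≤ M)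
    (hℓ0 : ∀ v, 0 ≤ ℓ v) (hℓh : ∀ t : Tuple m k, t.inputs ⊆ X → ℓ (margins f t) ≤ h t)
    (P : Measure (Euc m)) [IsProbabilityMeasure P] (Q : Fin k → Measure (Euc m))
    [∀ i, IsProbabilityMeasure (Q i)] (hP : ∀ᵐ x ∂P, x ∈ X) (hQ : ∀ i, ∀ᵐ x ∂(Q i), x ∈ X)
    {x : Euc m} (hx : x ∈ X) :
    ℓ (fun i => inner ℝ (∫ y, f y ∂P) (f x) - inner ℝ (∫ y, f y ∂(Q i)) (f x))
      ≤ ∫ q, h (x, q) ∂(P.prod (Measure.pi Q)) := by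
  have hint : ∀ (ρ : Measure (Euc m)) [IsProbabilityMeasure ρ], (∀ᵐ x ∂ρ, x ∈ X) →
      Integrable f ρ := fun ρ _ hρ =>
    Integrable.of_bound hf.aestronglyMeasurable C (hρ.mono fun y hy => hfC y hy)
  have haeX : ∀ᵐ q ∂(P.prod (Measure.pi Q)), Tuple.inputs ((x, q) : Tuple m k) ⊆ X := by
    have e1 : ∀ᵐ q ∂(P.prod (Measure.pi Q)), q.1 ∈ X :=
      Measure.quasiMeasurePreserving_fst.ae hP
    have e2 : ∀ᵐ q ∂(P.prod (Measure.pi Q)), ∀ i, q.2 i ∈ X :=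
      Measure.quasiMeasurePreserving_snd.ae (p := fun w : Fin k → Euc m => ∀ i, w i ∈ X) (ae_all_iff.2 fun i =>
        (measurePreserving_eval Q i).quasiMeasurePreserving.ae (hQ i))
    filter_upwards [e1, e2] with q h1 h2
    rintro y ((rfl | rfl) | ⟨i, rfl⟩)
    exacts [hx, h1, h2 i]
  set ν := P.prod (Measure.pi Q)
  let G : Euc m × (Fin k → Euc m) → Fin k → ℝ := fun q => margins f ((x, q) : Tuple m k)
  have hGc : Continuous G := (margins_continuous hf).comp (Continuous.prodMk_right x)
  have hI1 : Integrable (fun q : Euc m × (Fin k → Euc m) => f q.1) ν :=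
    (hint P hP).comp_fst _
  have hev : ∀ i, MeasurePreserving (fun q : Euc m × (Fin k → Euc m) => q.2 i) ν (Q i) :=
    fun i => (measurePreserving_eval Q i).comp measurePreserving_snd
  have hI2 : ∀ i, Integrable (fun q : Euc m × (Fin k → Euc m) => f (q.2 i)) ν := fun i =>
    (hev i).integrable_comp_of_integrable (hint (Q i) (hQ i))
  have hGi : ∀ i, Integrable (fun q => G q i) ν := fun i =>
    ((hI1.sub (hI2 i)).const_inner (f x))
  have hGint : Integrable G ν := Integrable.of_eval hGi
  have hmean : ∫ q, G q ∂ν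
      = fun i => inner ℝ (∫ y, f y ∂P) (f x) - inner ℝ (∫ y, f y ∂(Q i)) (f x) := by
    funext i
    rw [eval_integral hGi]
    have e1 : ∫ q, f q.1 ∂ν = ∫ y, f y ∂P := by
      simp [ν, integral_fun_fst]
    have e2 : ∫ q, f (q.2 i) ∂ν = ∫ y, f y ∂(Q i) := by
      rw [← (hev i).map_eq, integral_map (hev i).measurable.aemeasurable hf.aestronglyMeasurable]
    have e3 : ∀ q, G q i = inner ℝ (f x) (f q.1 - f (q.2 i)) := fun q => rfl
    simp only [e3]
    rw [integral_inner (f := fun q : Euc m × (Fin k → Euc m) => f q.1 - f (q.2 i))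
      (hI1.sub (hI2 i)), integral_sub hI1 (hI2 i), e1, e2, inner_sub_right,
      real_inner_comm, real_inner_comm (f x) (∫ y, f y ∂(Q i))]
  have hhint : Integrable (fun q => h (x, q)) ν :=
    integrable_of_abs_le (hmeas.comp measurable_prodMk_left) (C := M) fun q => by
      rw [abs_of_nonneg (h0 _)]; exact hM _
  have hle : ∀ᵐ q ∂ν, ℓ (G q) ≤ h (x, q) := haeX.mono fun q hq => hℓh _ hq
  have hℓint : Integrable (ℓ ∘ G) ν := by
    refine hhint.mono (hℓc.comp hGc).aestronglyMeasurable (hle.mono fun q hq => ?_)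
    rw [Function.comp, Real.norm_of_nonneg (hℓ0 _), Real.norm_of_nonneg (h0 _)]
    exact hq
  rw [← hmean]
  refine ((hconv.closure_of_continuous hℓc).map_integral_le hℓc.continuousOn isClosed_closure
    (haeX.mono fun q hq => subset_closure (subset_convexHull ℝ V (hV _ hq))) hGint hℓint).trans ?_
  exact integral_mono_ae hℓint hhint hle

end Jensen
end DCRL

namespace DCRL

/-! ### From weighted task risks to the unsupervised risk. -/

section Tasks

variable {m p k : ℕ} {𝒞 : Type*} (prior : PMF 𝒞) (D : 𝒞 → Measure (Euc m))
variable {X : Set (Euc m)} {f : Euc m → Euc p} {C : ℝ} {V : Set (Fin k → ℝ)}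
  {ℓ : (Fin k → ℝ) → ℝ}

lemma supRisk_nonneg (hℓ0 : ∀ v, 0 ≤ ℓ v) (lab : PMF (Fin (k + 1))) (T : Fin (k + 1) ↪ 𝒞)
    (g : Euc m → Fin (k + 1) → ℝ) : 0 ≤ supRisk ℓ D lab T g :=
  integral_nonneg fun _ => hℓ0 _

variable [∀ c, IsProbabilityMeasure (D c)]

/-- Jensen's inequality is applied for each label and each input drawn from its class. Averaging
over the input reassembles the law of a tuple with the prescribed classes. -/
lemma supRisk_meanClassifier_le (hf : Continuous f) (hfC : ∀ x ∈ X, ‖f x‖ ≤ C)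
    (hV : ∀ t : Tuple m k, t.inputs ⊆ X → margins f t ∈ V)
    (hℓc : Continuous ℓ) (hconv : ConvexOn ℝ (convexHull ℝ V) ℓ)
    {h : Tuple m k → ℝ} (hmeas : Measurable h) {M : ℝ} (h0 : ∀ t, 0 ≤ h t) (hM : ∀ t, h t ≤ M)
    (hℓ0 : ∀ v, 0 ≤ ℓ v) (hℓh : ∀ t : Tuple m k, t.inputs ⊆ X → ℓ (margins f t) ≤ h t)
    (hD : ∀ c, ∀ᵐ x ∂(D c), x ∈ X) (lab : PMF (Fin (k + 1))) (T : Fin (k + 1) ↪ 𝒞) :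
    supRisk ℓ D lab T (meanClassifier D T f)
      ≤ ∑ j, (lab j).toReal * ∫ t, h t ∂(classTupleLaw D (T j) fun i => T (j.succAbove i)) := by
  have hE0 : ∀ j, 0 ≤ ∫ t, h t ∂(classTupleLaw D (T j) fun i => T (j.succAbove i)) :=
    fun j => integral_nonneg h0
  have hhint : ∀ j, Integrable h (classTupleLaw D (T j) fun i => T (j.succAbove i)) := fun j =>
    integrable_of_abs_le hmeas (C := M) fun t => by rw [abs_of_nonneg (h0 t)]; exact hM t
  have key : ENNReal.ofReal (supRisk ℓ D lab T (meanClassifier D T f))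
      ≤ ∑ j, lab j * ENNReal.ofReal
        (∫ t, h t ∂(classTupleLaw D (T j) fun i => T (j.succAbove i))) := by
    refine (ofReal_integral_le_lintegral fun _ => hℓ0 _).trans ?_
    rw [labelledLaw, lintegral_sum_measure, tsum_fintype]
    refine Finset.sum_le_sum fun j _ => ?_
    rw [lintegral_smul_measure, smul_eq_mul]
    gcongr
    rw [Measure.prod_dirac]
    refine (lintegral_map_le _ _).trans ?_
    have hF : Measurable fun t => ENNReal.ofReal (h t) := hmeas.ennreal_ofReal
    rw [ofReal_integral_eq_lintegral_ofReal (hhint j) (ae_of_all _ h0), classTupleLaw,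
      lintegral_prod _ hF.aemeasurable]
    refine lintegral_mono_ae ((hD (T j)).mono fun x hx => ?_)
    rw [← ofReal_integral_eq_lintegral_ofReal (f := fun q => h (x, q)) (integrable_of_abs_le
      (hmeas.comp measurable_prodMk_left) (C := M) fun t => by
        rw [abs_of_nonneg (h0 _)]; exact hM _) (ae_of_all _ fun _ => h0 _)]
    exact ENNReal.ofReal_le_ofReal (loss_mean_le hf hfC hV hℓc hconv hmeas h0 hM hℓ0 hℓh (D (T j))
      (fun i => D (T (j.succAbove i))) (hD _) (fun i => hD _) hx)
  have hR0 : 0 ≤ ∑ j, (lab j).toReal *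
      ∫ t, h t ∂(classTupleLaw D (T j) fun i => T (j.succAbove i)) :=
    Finset.sum_nonneg fun j _ => mul_nonneg ENNReal.toReal_nonneg (hE0 j)
  rw [← ENNReal.ofReal_le_ofReal_iff hR0]
  refine key.trans_eq ?_
  rw [ENNReal.ofReal_sum_of_nonneg fun j _ => mul_nonneg ENNReal.toReal_nonneg (hE0 j)]
  refine Finset.sum_congr rfl fun j _ => ?_
  rw [ENNReal.ofReal_mul ENNReal.toReal_nonneg, ENNReal.ofReal_toReal (lab.apply_ne_top j)]

lemma anchorProb_eq (T : Fin (k + 1) ↪ 𝒞) (j : Fin (k + 1)) :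
    anchorProb prior T j = k.factorial *
      (prior (T j) * ∏ i, ((negMass prior (T j))⁻¹ * prior (T (j.succAbove i)))).toReal := by
  rw [anchorProb, ENNReal.toReal_mul, ENNReal.toReal_prod]
  simp only [ENNReal.toReal_mul, ENNReal.toReal_inv, negMass_toReal, div_eq_inv_mul]

lemma taskProb_nonneg (T : Fin (k + 1) ↪ 𝒞) : 0 ≤ taskProb prior T :=
  div_nonneg (Finset.prod_nonneg fun _ _ => ENNReal.toReal_nonneg)
    (tsum_nonneg fun _ => Finset.prod_nonneg fun _ _ => ENNReal.toReal_nonneg)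

lemma anchorProb_nonneg (T : Fin (k + 1) ↪ 𝒞) (j : Fin (k + 1)) : 0 ≤ anchorProb prior T j := by
  rw [anchorProb_eq]; positivity

lemma taskWeight_nonneg (lab : PMF (Fin (k + 1))) (T : Fin (k + 1) ↪ 𝒞) :
    0 ≤ taskWeight prior lab T :=
  div_nonneg (div_nonneg (Real.iInf_nonneg fun j => anchorProb_nonneg prior T j)
    (mul_nonneg (Nat.cast_nonneg _) (taskProb_nonneg prior T)))
    (Real.iSup_nonneg fun _ => ENNReal.toReal_nonneg)

/-- The weight divides out the task probability. Its minimum over anchors is at most the value at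
`j`, and its maximal label probability absorbs that of `j`. -/
lemma taskProb_mul_taskWeight_mul_le (lab : PMF (Fin (k + 1))) (T : Fin (k + 1) ↪ 𝒞)
    (j : Fin (k + 1)) :
    taskProb prior T * (taskWeight prior lab T * (lab j).toReal)
      ≤ anchorProb prior T j / (k + 1).factorial := by
  have hanchor := anchorProb_nonneg prior T j
  rcases (taskProb_nonneg prior T).eq_or_lt with h | h
  · rw [← h, zero_mul]; positivity
  have h1 : (⨅ i, anchorProb prior T i) ≤ anchorProb prior T j :=
    ciInf_le (Set.finite_range _).bddBelow j
  have h1' : 0 ≤ ⨅ i, anchorProb prior T i := Real.iInf_nonneg fun i => anchorProb_nonneg prior T i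
  have h2 : (lab j).toReal / (⨆ i, (lab i).toReal) ≤ 1 :=
    div_le_one_of_le₀ (le_ciSup (f := fun i => (lab i).toReal) (Set.finite_range _).bddAbove j)
      (Real.iSup_nonneg fun _ => ENNReal.toReal_nonneg)
  calc taskProb prior T * (taskWeight prior lab T * (lab j).toReal)
      = (⨅ i, anchorProb prior T i) / (k + 1).factorial *
          ((lab j).toReal / (⨆ i, (lab i).toReal)) := by
        rw [taskWeight]; field_simp
    _ ≤ (⨅ i, anchorProb prior T i) / (k + 1).factorial * 1 := by gcongr
    _ ≤ _ := by rw [mul_one]; gcongr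

/-- The weighted supervised risk of the mean classifiers is bounded by the unsupervised risk, for
any bounded loss that dominates the given one. -/
theorem summable_and_tsum_supRisk_le (hpos : ∀ c, negMass prior c ≠ 0) (hf : Continuous f)
    (hfC : ∀ x ∈ X, ‖f x‖ ≤ C) (hV : ∀ t : Tuple m k, t.inputs ⊆ X → margins f t ∈ V)
    (hℓc : Continuous ℓ) (hconv : ConvexOn ℝ (convexHull ℝ V) ℓ)
    {h : Tuple m k → ℝ} (hmeas : Measurable h) {M : ℝ} (h0 : ∀ t, 0 ≤ h t) (hM : ∀ t, h t ≤ M)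
    (hℓ0 : ∀ v, 0 ≤ ℓ v) (hℓh : ∀ t : Tuple m k, t.inputs ⊆ X → ℓ (margins f t) ≤ h t)
    (hD : ∀ c, ∀ᵐ x ∂(D c), x ∈ X) (lab : (Fin (k + 1) ↪ 𝒞) → PMF (Fin (k + 1))) :
    (Summable fun T : Fin (k + 1) ↪ 𝒞 => taskProb prior T * (taskWeight prior (lab T) T *
        supRisk ℓ D (lab T) T (meanClassifier D T f))) ∧
      ∑' T : Fin (k + 1) ↪ 𝒞, taskProb prior T * (taskWeight prior (lab T) T *
        supRisk ℓ D (lab T) T (meanClassifier D T f)) ≤ ∫ t, h t ∂(tupleLaw prior D k) := by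
  have := isProbabilityMeasure_tupleLaw prior D hpos k
  set term : (Fin (k + 1) ↪ 𝒞) → ℝ := fun T => taskProb prior T * (taskWeight prior (lab T) T *
        supRisk ℓ D (lab T) T (meanClassifier D T f))
  have hterm0 : ∀ T, 0 ≤ term T := fun T => mul_nonneg (taskProb_nonneg prior T)
    (mul_nonneg (taskWeight_nonneg prior _ T) (supRisk_nonneg D hℓ0 _ T _))
  let E : (Fin (k + 1) ↪ 𝒞) → Fin (k + 1) → ℝ := fun T j =>
    ∫ t, h t ∂(classTupleLaw D (T j) fun i => T (j.succAbove i))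
  have hE0 : ∀ T j, 0 ≤ E T j := fun T j => integral_nonneg h0
  have hint : ∀ (ν : Measure (Tuple m k)) [IsProbabilityMeasure ν], Integrable h ν := fun ν _ =>
    integrable_of_abs_le hmeas (C := M) fun t => by rw [abs_of_nonneg (h0 t)]; exact hM t
  let w : (Fin (k + 1) ↪ 𝒞) → Fin (k + 1) → ℝ≥0∞ := fun T j =>
    prior (T j) * ∏ i, ((negMass prior (T j))⁻¹ * prior (T (j.succAbove i)))
  have hw : ∀ T j, w T j ≠ ∞ := fun T j =>
    ENNReal.mul_ne_top (prior.apply_ne_top _) (ENNReal.prod_ne_top fun i _ =>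
      ENNReal.mul_ne_top (ENNReal.inv_ne_top.2 (hpos _)) (prior.apply_ne_top _))
  have hterm : ∀ T, term T ≤ ∑ j, ((k : ℝ) + 1)⁻¹ * ((w T j).toReal * E T j) := fun T => by
    calc term T ≤ taskProb prior T * (taskWeight prior (lab T) T *
          ∑ j, ((lab T) j).toReal * E T j) :=
          mul_le_mul_of_nonneg_left (mul_le_mul_of_nonneg_left
            (supRisk_meanClassifier_le D hf hfC hV hℓc hconv hmeas h0 hM hℓ0 hℓh hD (lab T) T)
            (taskWeight_nonneg prior _ T)) (taskProb_nonneg prior T)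
      _ = ∑ j, taskProb prior T * (taskWeight prior (lab T) T * ((lab T) j).toReal) * E T j := by
          rw [Finset.mul_sum, Finset.mul_sum]
          exact Finset.sum_congr rfl fun j _ => by ring
      _ ≤ ∑ j, anchorProb prior T j / (k + 1).factorial * E T j := by
          refine Finset.sum_le_sum fun j _ => ?_
          exact mul_le_mul_of_nonneg_right (taskProb_mul_taskWeight_mul_le prior (lab T) T j)
            (hE0 T j)
      _ = _ := by
          refine Finset.sum_congr rfl fun j _ => ?_
          -- The `k!` orders of the negative classes cancel against `(k + 1)!` and leave `1 / (k +
          -- 1)`, the average over anchor positions.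
          rw [anchorProb_eq, Nat.factorial_succ]
          push_cast
          have : (k.factorial : ℝ) ≠ 0 := by positivity
          field_simp
          exact mul_comm _ _
  have hsum : ∑' T, ENNReal.ofReal (term T) ≤ ENNReal.ofReal (∫ t, h t ∂(tupleLaw prior D k)) := by
    calc ∑' T, ENNReal.ofReal (term T)
        ≤ ∑' T, ∑ j, ENNReal.ofReal ((k : ℝ) + 1)⁻¹ * (w T j *
          ∫⁻ t, ENNReal.ofReal (h t) ∂(classTupleLaw D (T j) fun i => T (j.succAbove i))) := by
          refine ENNReal.tsum_le_tsum fun T => (ENNReal.ofReal_le_ofReal (hterm T)).trans_eq ?_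
          rw [ENNReal.ofReal_sum_of_nonneg fun j _ => mul_nonneg (by positivity)
            (mul_nonneg ENNReal.toReal_nonneg (hE0 T j))]
          refine Finset.sum_congr rfl fun j _ => ?_
          rw [ENNReal.ofReal_mul (by positivity), ENNReal.ofReal_mul ENNReal.toReal_nonneg,
            ENNReal.ofReal_toReal (hw T j),
            ofReal_integral_eq_lintegral_ofReal (hint _) (ae_of_all _ h0)]
      _ = ∑ j, ENNReal.ofReal ((k : ℝ) + 1)⁻¹ * ∑' T, (w T j *
          ∫⁻ t, ENNReal.ofReal (h t) ∂(classTupleLaw D (T j) fun i => T (j.succAbove i))) := by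
          rw [Summable.tsum_finsetSum fun _ _ => ENNReal.summable]
          simp only [ENNReal.tsum_mul_left]
      _ ≤ ∑ _j : Fin (k + 1), ENNReal.ofReal ((k : ℝ) + 1)⁻¹ *
          ∫⁻ t, ENNReal.ofReal (h t) ∂(tupleLaw prior D k) := by
          refine Finset.sum_le_sum fun j _ => ?_
          gcongr
          exact tsum_task_lintegral_le prior D hpos hmeas.ennreal_ofReal j
      _ = ENNReal.ofReal (∫ t, h t ∂(tupleLaw prior D k)) := by
          rw [← ofReal_integral_eq_lintegral_ofReal (hint _) (ae_of_all _ h0),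
            Finset.sum_const, Finset.card_univ, Fintype.card_fin, nsmul_eq_mul, ← mul_assoc]
          have : ((k + 1 : ℕ) : ℝ≥0∞) * ENNReal.ofReal ((k : ℝ) + 1)⁻¹ = 1 := by
            rw [← ENNReal.ofReal_natCast, ← ENNReal.ofReal_mul (Nat.cast_nonneg _)]
            push_cast
            rw [mul_inv_cancel₀ (by positivity), ENNReal.ofReal_one]
          rw [this, one_mul]
  have hsummable : Summable term := by
    have h1 := ENNReal.summable_toReal (hsum.trans_lt ENNReal.ofReal_lt_top).ne
    simpa only [ENNReal.toReal_ofReal (hterm0 _)] using h1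
  refine ⟨hsummable, ?_⟩
  rw [← ENNReal.ofReal_tsum_of_nonneg hterm0 hsummable,
    ENNReal.ofReal_le_ofReal_iff (integral_nonneg h0)] at hsum
  exact hsum

end Tasks
end DCRL

/-! ### Expected uniform deviation of the augmented losses. -/

namespace DCRL

namespace NetSpec

variable {L : ℕ} (N : NetSpec L) {k : ℕ} {b : ℕ → ℝ} {ℓ : (Fin k → ℝ) → ℝ} {M η : ℝ}

lemma continuous_subnet {l : ℕ} (hl : l ≤ L) :
    Continuous fun q : N.Weights × Euc (N.d 0) => N.subnet q.1 l q.2 := by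
  induction l with
  | zero => exact continuous_snd
  | succ l ih =>
    have ih := ih (by omega)
    simp only [subnet]
    refine (N.act_lip l hl).continuous.comp ?_
    simp only [Matrix.toLpLin_apply]
    refine (PiLp.continuous_toLp 2 _).comp ?_
    refine Continuous.matrix_mulVec ((continuous_apply l).comp continuous_fst) ?_
    exact (PiLp.continuous_ofLp 2 _).comp ih

lemma continuous_inp {m : ℕ} (i : Option (Option (Fin k))) :
    Continuous fun t : Tuple m k => t.inp i := by
  rcases i with _ | _ | i <;> simp only [Tuple.inp] <;> fun_prop

lemma continuous_augLoss (hℓ : Continuous ℓ) :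
    Continuous fun q : N.Weights × Tuple (N.d 0) k => N.augLoss b ℓ M q.1 q.2 := by
  have hsub : ∀ l ≤ L, ∀ i, Continuous fun q : N.Weights × Tuple (N.d 0) k =>
      N.subnet q.1 l (q.2.inp i) := fun l hl i =>
    (N.continuous_subnet hl).comp (continuous_fst.prodMk ((continuous_inp i).comp continuous_snd))
  have h1 : Continuous fun q : N.Weights × Tuple (N.d 0) k => margins (N.net q.1) q.2 := by
    refine continuous_pi fun i => ?_
    exact (hsub L le_rfl none).inner ((hsub L le_rfl (some none)).sub
      (hsub L le_rfl (some (some i))))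
  have h2 : Continuous fun q : N.Weights × Tuple (N.d 0) k => N.overshoot b q.1 q.2 := by
    unfold overshoot
    refine NNReal.continuous_coe.comp (Continuous.finset_sup_apply fun q _ => ?_)
    refine continuous_real_toNNReal.comp ?_
    have := hsub (q.1 + 1) q.1.2 q.2
    fun_prop
  unfold augLoss
  exact ((hℓ.comp h1).min continuous_const).max (continuous_const.mul h2)

lemma continuous_net {A : N.Weights} : Continuous (N.net A) :=
  (N.continuous_subnet le_rfl).comp (Continuous.prodMk_right A)

lemma measurable_augLoss (hℓ : Continuous ℓ) (A : N.Weights) :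
    Measurable fun t : Tuple (N.d 0) k => N.augLoss b ℓ M A t :=
  ((N.continuous_augLoss hℓ).comp (Continuous.prodMk_right A)).measurable

/-- Without violations the overshoot vanishes and the augmented loss is at most the loss; on a
violating tuple it is at most `M`. -/
lemma augLoss_le_add (hb : ∀ l ≤ L, 1 ≤ b l) (hM : 0 < M) (hℓ0 : ∀ v, 0 ≤ ℓ v) {n : ℕ}
    (S : Fin n → Tuple (N.d 0) k) (A : N.Weights) :
    ∑ j, N.augLoss b ℓ M A (S j)
      ≤ ∑ j, ℓ (margins (N.net A) (S j)) + M * N.numViolations b S A := by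
  classical
  have hpt : ∀ j, N.augLoss b ℓ M A (S j) ≤ ℓ (margins (N.net A) (S j)) +
      M * if ∃ l, 1 ≤ l ∧ l ≤ L ∧ ∃ x ∈ (S j).inputs, b l < ‖N.subnet A l x‖ then 1 else 0 := by
    intro j
    split_ifs with h
    · linarith [N.augLoss_le (b := b) (ℓ := ℓ) hM A (S j), hℓ0 (margins (N.net A) (S j))]
    · push Not at h
      rw [augLoss, N.overshoot_eq_zero b hb A (S j) h, mul_zero, add_zero]
      exact max_le (min_le_left _ _) (hℓ0 _)
  refine (Finset.sum_le_sum fun j _ => hpt j).trans_eq ?_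
  rw [Finset.sum_add_distrib, ← Finset.mul_sum, Finset.sum_boole, numViolations,
    Set.ncard_eq_toFinset_card', Set.toFinset_ofPred]

variable {n : ℕ}

/-- The expected uniform deviation of the augmented losses. -/
lemma integral_deviation_le (hb : ∀ l ≤ L, 1 ≤ b l) (hη : 0 ≤ η) (hM : 0 < M)
    (hℓ : ∀ v w, |ℓ v - ℓ w| ≤ η * ‖v - w‖) (hℓc : Continuous ℓ) {r : ℝ} (hr : 0 < r)
    (hrb : N.complexity b ≤ r) (hn : 1 ≤ n) {μ : Measure (Tuple (N.d 0) k)} [IsProbabilityMeasure μ]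
    (hμ : ∀ᵐ t ∂μ, ∀ i, t.inp i ∈ Metric.closedBall (0 : Euc (N.d 0)) (3 * b 0))
    {ι : Type*} [Nonempty ι] [Countable ι] (A : ι → N.params) :
    ∫ S, ⨆ a, (n * ∫ t, N.augLoss b ℓ M (A a) t ∂μ - ∑ j, N.augLoss b ℓ M (A a) (S j))
        ∂(Measure.pi fun _ : Fin n => μ)
      ≤ n * (56 * max (η * b L ^ 2) M * (r / √n)) * (1 + 36 * (Nat.log 4 (36 * n) + 1 : ℕ) *
        √(Real.log (1 + N.width * (2 * n * (k + 2)) * (36 * n + 1) : ℕ))) := by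
  have hβ : 0 ≤ max (η * b L ^ 2) M := hM.le.trans (le_max_right _ _)
  have hn0 : (0 : ℝ) < n := by exact_mod_cast hn
  refine integral_iSup_deviation_le μ (fun a => N.measurable_augLoss hℓc (A a))
    (fun a t => N.augLoss_nonneg hM (A a) t) (fun a t => N.augLoss_le hM (A a) t) hμ
    fun Z hZ => ?_
  obtain ⟨a₀⟩ := ‹Nonempty ι›
  have : Nonempty N.params := ⟨A a₀⟩
  -- Sample and ghost sample are covered together, as `2 * n` tuples.
  let t : Fin n × Bool → Tuple (N.d 0) k := fun q => if q.2 then (Z q.1).1 else (Z q.1).2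
  have ht : ∀ q i, ‖(t q).inp i‖ ≤ 3 * b 0 := by
    rintro ⟨j, s⟩ i
    rw [← mem_closedBall_zero_iff]
    cases s
    · exact (hZ j).2 i
    · exact (hZ j).1 i
  -- The constant 56 is twice 28, because differences of two losses are approximated. The accuracy
  -- `r / √n * 2 ^ i` turns the entropy `36 * r ^ 2 / ε ^ 2` into `36 * n / 4 ^ i`.
  obtain ⟨f, hf1, hf2⟩ := exists_signAvg_le_of_dyadic_nets
    (fun (a : N.params) j => N.augLoss b ℓ M a (Z j).1 - N.augLoss b ℓ M a (Z j).2)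
    (K := Nat.log 4 (36 * n) + 1) (G := 1 + N.width * (2 * n * (k + 2)) * (36 * n + 1))
    (e := 56 * max (η * b L ^ 2) M * (r / √n))
    (by rw [Fintype.card_fin]; exact Nat.lt_pow_succ_log_self (by norm_num) _)
    (by omega) (by positivity) (fun i => by
      obtain ⟨rep, hfin, hcard, hrep⟩ := N.exists_augLoss_cover (b := b) (ℓ := ℓ) t ht hb hη hM hℓ
        hr hrb (ε := r / √n * 2 ^ i) (by positivity)
      have he : 36 * r ^ 2 / (r / √n * 2 ^ i) ^ 2 = 36 * n / 4 ^ i := by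
        have h4 : ((2 : ℝ) ^ i) ^ 2 = 4 ^ i := by rw [← pow_mul, mul_comm, pow_mul]; norm_num
        rw [mul_pow, div_pow, Real.sq_sqrt hn0.le, h4]
        field_simp
      rw [he] at hcard
      rw [Fintype.card_fin]
      refine ⟨rep, hfin, hcard.trans ?_, fun a j => ?_⟩
      · have hm : ⌊36 * (n : ℝ) / 4 ^ i⌋₊ ≤ 36 * n := by
          refine Nat.floor_le_of_le ?_
          push_cast
          exact div_le_self (by positivity) (one_le_pow₀ (by norm_num))
        refine Nat.pow_le_pow_left ?_ _
        simp only [Fintype.card_prod, Fintype.card_fin, Fintype.card_bool]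
        rw [mul_comm n 2]
        gcongr
      · have h1 := hrep a (j, true)
        have h2 := hrep a (j, false)
        simp only [t, if_true, Bool.false_eq_true, if_false] at h1 h2
        rw [abs_le] at h1 h2 ⊢
        constructor <;> linarith [h1.1, h1.2, h2.1, h2.2])
  refine ⟨f, fun a σ => hf1 (A a) σ, hf2.trans_eq ?_⟩
  rw [Fintype.card_fin]

/-- Without neurons, the augmented losses do not depend on the weights. -/
lemma integral_deviation_le_zero (hL : 1 ≤ L) (hM : 0 < M)
    (hℓc : Continuous ℓ) (hW : N.width = 0) {μ : Measure (Tuple (N.d 0) k)}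
    [IsProbabilityMeasure μ] {ι : Type*} [Nonempty ι] [Countable ι] (A : ι → N.params) :
    ∫ S, ⨆ a, (n * ∫ t, N.augLoss b ℓ M (A a) t ∂μ - ∑ j, N.augLoss b ℓ M (A a) (S j))
        ∂(Measure.pi fun _ : Fin n => μ) ≤ 0 := by
  refine integral_iSup_deviation_le μ (fun a => N.measurable_augLoss hℓc (A a))
    (fun a t => N.augLoss_nonneg hM (A a) t) (fun a t => N.augLoss_le hM (A a) t)
    (p := fun _ => True) (by simp) fun Z _ => ?_
  obtain ⟨a₀⟩ := ‹Nonempty ι›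
  have : Nonempty N.params := ⟨A a₀⟩
  have hsub : ∀ l, 1 ≤ l → l ≤ L → ∀ (B B' : N.Weights) x, N.subnet B l x = N.subnet B' l x := by
    intro l h1 hl B B' x
    obtain ⟨l, rfl⟩ : ∃ l', l = l' + 1 := ⟨l - 1, by omega⟩
    have h0 : N.d (l + 1) = 0 := by have := N.le_width hl; omega
    have : IsEmpty (Fin (N.d (l + 1))) := by rw [h0]; infer_instance
    exact Subsingleton.elim _ _
  have hnet : ∀ B B' : N.Weights, N.net B = N.net B' := fun B B' => by
    funext x; exact hsub L hL le_rfl B B' x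
  have haug : ∀ (B B' : N.Weights) (t : Tuple (N.d 0) k),
      N.augLoss b ℓ M B t = N.augLoss b ℓ M B' t := fun B B' t => by
    have h1 : ∀ (q : Fin L × Option (Option (Fin k))),
        N.subnet B (q.1 + 1) (t.inp q.2) = N.subnet B' (q.1 + 1) (t.inp q.2) :=
      fun q => hsub _ (by omega) q.1.2 B B' _
    simp only [augLoss, overshoot, hnet B B', h1]
  obtain ⟨f, hf1, hf2⟩ := exists_signAvg_le_of_nets
    (fun (a : N.params) j => N.augLoss b ℓ M a (Z j).1 - N.augLoss b ℓ M a (Z j).2) 0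
    (fun _ _ => A a₀) (fun _ => 1) (fun _ => 0) (fun _ => le_rfl)
    (fun _ => Set.finite_range_const) (fun _ => by simp)
    (fun i a j => by rw [haug a (A a₀), haug a (A a₀)]; simp) rfl
  refine ⟨f, fun a σ => hf1 (A a) σ, by simpa using hf2⟩

end NetSpec
end DCRL

/-! ### Explicit and high-probability forms of the deviation bound. -/

namespace DCRL

/-- The number of scales is at most `6 * y` and the root at most `12 * w * y`, giving `36 * 6 * 12 =
2592`. The summand 1 is absorbed by the remaining `2 * w * y ^ 2`. -/
lemma chaining_factor_le {n k W : ℕ} (hn : 1 ≤ n) (hk : 1 ≤ k) (hW : 1 ≤ W) :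
    1 + 36 * (Nat.log 4 (36 * n) + 1 : ℕ) *
        √(Real.log (1 + W * (2 * n * (k + 2)) * (36 * n + 1) : ℕ))
      ≤ 2594 * (Real.log (W + 1) * Real.log (2 + n + k) ^ 2) := by
  have hn' : (1 : ℝ) ≤ n := by exact_mod_cast hn
  have hk' : (1 : ℝ) ≤ k := by exact_mod_cast hk
  have hW' : (1 : ℝ) ≤ W := by exact_mod_cast hW
  set s : ℝ := 2 + n + k with hs
  set y := Real.log s
  set w := Real.log ((W : ℝ) + 1)
  have h4s : 4 ≤ s := by rw [hs]; linarith
  have hs0 : 0 < s := by linarith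
  have hlog2 := Real.log_two_gt_d9
  have hlog4 : Real.log 4 = 2 * Real.log 2 := by
    rw [show (4 : ℝ) = 2 ^ 2 by norm_num, Real.log_pow]; norm_num
  have hy : 1 ≤ y := by
    have : Real.log 4 ≤ y := Real.log_le_log (by norm_num) h4s
    linarith
  have hw : 0.69 ≤ w := by
    have : Real.log 2 ≤ w := Real.log_le_log (by norm_num) (by linarith)
    linarith
  have hK : ((Nat.log 4 (36 * n) + 1 : ℕ) : ℝ) ≤ 6 * y := by
    have h1 : 4 ^ Nat.log 4 (36 * n) ≤ 36 * n := Nat.pow_log_le_self 4 (by omega)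
    have h2 : ((4 : ℝ)) ^ Nat.log 4 (36 * n) ≤ 4 ^ 3 * s := by
      have : ((4 : ℝ)) ^ Nat.log 4 (36 * n) ≤ 36 * n := by exact_mod_cast h1
      rw [hs]; linarith
    have h3 := Real.log_le_log (by positivity) h2
    rw [Real.log_pow, Real.log_mul (by norm_num) hs0.ne', Real.log_pow, hlog4] at h3
    have h4 : Real.log 4 ≤ y := Real.log_le_log (by norm_num) h4s
    push_cast at h3 ⊢
    nlinarith [show (0 : ℝ) ≤ (Nat.log 4 (36 * n) : ℝ) from Nat.cast_nonneg _]
  have hG : Real.log (1 + W * (2 * n * (k + 2)) * (36 * n + 1) : ℕ) ≤ w + 7 * y := by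
    have h1 : ((1 + W * (2 * n * (k + 2)) * (36 * n + 1) : ℕ) : ℝ) ≤ (W + 1) * s ^ 7 := by
      push_cast
      have e1 : 2 * (n : ℝ) * (k + 2) ≤ 2 * (s * s) := by
        have : (n : ℝ) * (k + 2) ≤ s * s := by gcongr <;> rw [hs] <;> linarith
        linarith
      have e2 : 36 * (n : ℝ) + 1 ≤ 37 * s := by rw [hs]; linarith
      have e3 : (1 : ℝ) ≤ s ^ 7 := one_le_pow₀ (by linarith)
      have e4 : (256 : ℝ) ≤ s ^ 4 := by
        calc (256 : ℝ) = 4 ^ 4 := by norm_num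
          _ ≤ _ := by gcongr
      calc 1 + (W : ℝ) * (2 * n * (k + 2)) * (36 * n + 1)
          ≤ s ^ 7 + W * (2 * (s * s)) * (37 * s) := by gcongr
        _ = s ^ 7 + W * (74 * s ^ 3) := by ring
        _ ≤ s ^ 7 + W * (s ^ 4 * s ^ 3) := by gcongr; linarith
        _ = _ := by ring
    refine (Real.log_le_log (by positivity) h1).trans_eq ?_
    rw [Real.log_mul (by positivity) (by positivity), Real.log_pow]
    norm_num [w, y]
  have hwy : w + 7 * y ≤ 12 * (w * y) := by nlinarith
  have hwy1 : 1 ≤ 12 * (w * y) := by nlinarith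
  have hsqrt : √(Real.log (1 + W * (2 * n * (k + 2)) * (36 * n + 1) : ℕ)) ≤ 12 * (w * y) := by
    refine Real.sqrt_le_iff.2 ⟨by linarith, ?_⟩
    nlinarith
  calc _ ≤ 1 + 36 * (6 * y) * (12 * (w * y)) := by gcongr
    _ = 1 + 2592 * (w * y ^ 2) := by ring
    _ ≤ _ := by
      have : 0.69 ≤ w * y ^ 2 := by
        have : 1 ≤ y ^ 2 := one_le_pow₀ hy
        nlinarith
      linarith

namespace NetSpec

variable {L : ℕ} (N : NetSpec L) {k n : ℕ} {b : ℕ → ℝ} {ℓ : (Fin k → ℝ) → ℝ} {M η : ℝ}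

lemma complexity_nonneg (hb : ∀ l ≤ L, 1 ≤ b l) : 0 ≤ N.complexity b :=
  Real.rpow_nonneg (Finset.sum_nonneg fun i hi => Real.rpow_nonneg
    (mul_nonneg (mul_nonneg (N.a_pos i (Finset.mem_range.1 hi)).le
      (by linarith [hb i (Finset.mem_range.1 hi).le]))
      (N.lipHat_nonneg b hb (Finset.mem_range.1 hi))) _) _

lemma integral_deviation_le_complexity (hL : 1 ≤ L) (hk : 1 ≤ k) (hb : ∀ l ≤ L, 1 ≤ b l)
    (hη : 0 ≤ η) (hM : 0 < M) (hℓ : ∀ v w, |ℓ v - ℓ w| ≤ η * ‖v - w‖) (hℓc : Continuous ℓ)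
    (hn : 1 ≤ n) {μ : Measure (Tuple (N.d 0) k)} [IsProbabilityMeasure μ]
    (hμ : ∀ᵐ t ∂μ, ∀ i, t.inp i ∈ Metric.closedBall (0 : Euc (N.d 0)) (3 * b 0))
    {ι : Type*} [Nonempty ι] [Countable ι] (A : ι → N.params) :
    ∫ S, ⨆ a, (n * ∫ t, N.augLoss b ℓ M (A a) t ∂μ - ∑ j, N.augLoss b ℓ M (A a) (S j))
        ∂(Measure.pi fun _ : Fin n => μ)
      ≤ n * (150000 * (max (η * b L ^ 2) M * N.complexity b / √n * Real.log (N.width + 1)) *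
        Real.log (2 + n + k + max (η * b L ^ 2) M * N.complexity b) ^ 2) := by
  have hR := N.complexity_nonneg hb
  have hβ : 0 ≤ max (η * b L ^ 2) M := hM.le.trans (le_max_right _ _)
  have hn' : (1 : ℝ) ≤ n := by exact_mod_cast hn
  rcases Nat.eq_zero_or_pos N.width with hW | hW
  -- For width zero the claimed bound is zero because of the factor `log (W + 1)`, so the chaining
  -- bound does not give it.
  · refine (N.integral_deviation_le_zero hL hM hℓc hW A).trans_eq ?_
    simp [hW]
  set I := ∫ S, ⨆ a, (n * ∫ t, N.augLoss b ℓ M (A a) t ∂μ - ∑ j, N.augLoss b ℓ M (A a) (S j))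
        ∂(Measure.pi fun _ : Fin n => μ)
  set β := max (η * b L ^ 2) M
  set R := N.complexity b
  set Θ : ℝ := 1 + 36 * (Nat.log 4 (36 * n) + 1 : ℕ) *
        √(Real.log (1 + N.width * (2 * n * (k + 2)) * (36 * n + 1) : ℕ))
  have hΘ0 : 0 ≤ Θ := by positivity
  have hΘ : Θ ≤ 2594 * (Real.log (N.width + 1) * Real.log (2 + n + k) ^ 2) :=
    chaining_factor_le hn hk hW
  have h1 : I ≤ n * (56 * β * (R / √n)) * Θ := by
    -- The complexity may vanish while the covers need a positive radius, so the bound is obtained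
    -- for every `r > R` and passed to the limit.
    have hcont : Continuous fun r : ℝ => n * (56 * β * (r / √n)) * Θ := by fun_prop
    refine ge_of_tendsto (hcont.continuousWithinAt (s := Set.Ioi R) (x := R)).tendsto ?_
    filter_upwards [self_mem_nhdsWithin] with r hr
    exact N.integral_deviation_le hb hη hM hℓ hℓc (hR.trans_lt hr) (le_of_lt hr) hn hμ A
  have hlog0 : 0 ≤ Real.log (2 + n + k) := Real.log_nonneg (by linarith [Nat.cast_nonneg (α := ℝ) k])
  have hw0 : 0 ≤ Real.log ((N.width : ℝ) + 1) :=
    Real.log_nonneg (by linarith [Nat.cast_nonneg (α := ℝ) N.width])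
  have hlog : Real.log (2 + n + k) ≤ Real.log (2 + n + k + β * R) :=
    Real.log_le_log (by positivity) (by linarith [mul_nonneg hβ hR])
  calc I ≤ n * (56 * β * (R / √n)) * Θ := h1
    _ ≤ n * (56 * β * (R / √n)) *
        (2594 * (Real.log (N.width + 1) * Real.log (2 + n + k + β * R) ^ 2)) := by
        refine mul_le_mul_of_nonneg_left (hΘ.trans ?_) (by positivity)
        gcongr
    _ = 145264 * (n * ((β * R / √n * Real.log (N.width + 1)) *
        Real.log (2 + n + k + β * R) ^ 2)) := by ring
    _ ≤ 150000 * (n * ((β * R / √n * Real.log (N.width + 1)) *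
        Real.log (2 + n + k + β * R) ^ 2)) := by
        refine mul_le_mul_of_nonneg_right (by norm_num) ?_
        positivity
    _ = _ := by ring

instance : SecondCountableTopology N.Weights :=
  inferInstanceAs (SecondCountableTopology ((l : ℕ) → Fin (N.d (l + 1)) → Fin (N.d l) → ℝ))

lemma continuous_augLoss_params (hℓc : Continuous ℓ) (t : Tuple (N.d 0) k) :
    Continuous fun a : N.params => N.augLoss b ℓ M a t := by
  have h1 : Continuous fun a : N.params => ((a : N.Weights), t) :=
    Continuous.prodMk continuous_subtype_val continuous_const
  have h2 := (N.continuous_augLoss (b := b) (M := M) hℓc).comp h1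
  exact h2

lemma continuous_integral_augLoss (hM : 0 < M) (hℓc : Continuous ℓ)
    {μ : Measure (Tuple (N.d 0) k)} [IsProbabilityMeasure μ] :
    Continuous fun a : N.params => ∫ t, N.augLoss b ℓ M a t ∂μ := by
  refine continuous_of_dominated (bound := fun _ => M)
    (fun a => (N.measurable_augLoss hℓc a).aestronglyMeasurable) (fun a => ae_of_all _ fun t => ?_)
    (integrable_const _) (ae_of_all _ (N.continuous_augLoss_params hℓc))
  rw [Real.norm_of_nonneg (N.augLoss_nonneg hM a t)]
  exact N.augLoss_le hM a t

/-- Allows the supremum to be taken over a dense sequence, where it is measurable, and the resulting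
bound to be extended to all parameters. -/
lemma continuous_deviation (hM : 0 < M) (hℓc : Continuous ℓ)
    {μ : Measure (Tuple (N.d 0) k)} [IsProbabilityMeasure μ] (S : Fin n → Tuple (N.d 0) k) :
    Continuous fun a : N.params =>
      n * ∫ t, N.augLoss b ℓ M a t ∂μ - ∑ j, N.augLoss b ℓ M a (S j) :=
  (continuous_const.mul (N.continuous_integral_augLoss hM hℓc)).sub
    (continuous_finsetSum _ fun j _ => N.continuous_augLoss_params hℓc (S j))

/-- With high probability, the population average of the augmented loss is bounded by its
empirical average uniformly over the class of networks. -/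
lemma measure_deviation_le (hL : 1 ≤ L) (hk : 1 ≤ k) (hb : ∀ l ≤ L, 1 ≤ b l)
    (hη : 0 ≤ η) (hM : 0 < M) (hℓ : ∀ v w, |ℓ v - ℓ w| ≤ η * ‖v - w‖) (hℓc : Continuous ℓ)
    (hn : 1 ≤ n) {μ : Measure (Tuple (N.d 0) k)} [IsProbabilityMeasure μ]
    (hμ : ∀ᵐ t ∂μ, ∀ i, t.inp i ∈ Metric.closedBall (0 : Euc (N.d 0)) (3 * b 0))
    {δ : ℝ} (hδ : 0 < δ) (hδ1 : δ < 1) :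
    (Measure.pi fun _ : Fin n => μ) {S | ¬ ∀ A ∈ N.params, ∫ t, N.augLoss b ℓ M A t ∂μ
      ≤ (∑ j, N.augLoss b ℓ M A (S j)) / n + M * √(Real.log (2 / δ) / (2 * n))
        + 150000 * (max (η * b L ^ 2) M * N.complexity b / √n * Real.log (N.width + 1)) *
          Real.log (2 + n + k + max (η * b L ^ 2) M * N.complexity b) ^ 2} ≤ ENNReal.ofReal δ := by
  have hn0 : (0 : ℝ) < n := by exact_mod_cast hn
  rcases isEmpty_or_nonempty N.params with hempty | hne
  · have : ∀ A, A ∉ N.params := fun A hA => hempty.elim ⟨A, hA⟩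
    simp [this]
  let A : ℕ → N.params := TopologicalSpace.denseSeq N.params
  have hmeas : ∀ a, Measurable fun t : Tuple (N.d 0) k => N.augLoss b ℓ M (A a) t :=
    fun a => N.measurable_augLoss hℓc (A a)
  have h0 : ∀ a (t : Tuple (N.d 0) k), 0 ≤ N.augLoss b ℓ M (A a) t :=
    fun a t => N.augLoss_nonneg hM (A a) t
  have hM' : ∀ a (t : Tuple (N.d 0) k), N.augLoss b ℓ M (A a) t ≤ M :=
    fun a t => N.augLoss_le hM (A a) t
  let f : (Fin n → Tuple (N.d 0) k) → ℝ := fun S =>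
    ⨆ a, (n * ∫ t, N.augLoss b ℓ M (A a) t ∂μ - ∑ j, N.augLoss b ℓ M (A a) (S j))
  have hf : Measurable f := by
    refine Measurable.iSup fun a => ?_
    have := hmeas a
    fun_prop
  have hbdd : ∀ S : Fin n → Tuple (N.d 0) k, BddAbove (Set.range fun a => n * ∫ t, N.augLoss b ℓ M (A a) t ∂μ
      - ∑ j, N.augLoss b ℓ M (A a) (S j)) := fun S => bddAbove_deviation μ hmeas h0 hM' S
  have hdiff : ∀ (S : Fin n → Tuple (N.d 0) k) i x, f (Function.update S i x) ≤ f S + M := by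
    intro S i x
    refine ciSup_le fun a => ?_
    have h1 := le_ciSup (hbdd S) a
    have h2 : ∑ j, N.augLoss b ℓ M (A a) (S j)
        ≤ ∑ j, N.augLoss b ℓ M (A a) (Function.update S i x j) + M := by
      rw [← Finset.add_sum_erase _ _ (Finset.mem_univ i),
        ← Finset.add_sum_erase (a := i)
          (f := fun j => N.augLoss b ℓ M (A a) (Function.update S i x j)) _ (Finset.mem_univ i)]
      have h3 : ∑ j ∈ Finset.univ.erase i, N.augLoss b ℓ M (A a) (Function.update S i x j)
          = ∑ j ∈ Finset.univ.erase i, N.augLoss b ℓ M (A a) (S j) :=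
        Finset.sum_congr rfl fun j hj => by
          rw [Function.update_of_ne (Finset.ne_of_mem_erase hj)]
      rw [h3]
      have := hM' a (S i)
      have := h0 a (Function.update S i x i)
      linarith
    simp only [f]
    linarith
  set τ := √(Real.log (2 / δ) / (2 * n)) with hτ
  set B := 150000 * (max (η * b L ^ 2) M * N.complexity b / √n * Real.log (N.width + 1)) *
          Real.log (2 + n + k + max (η * b L ^ 2) M * N.complexity b) ^ 2
  have hlog : 0 ≤ Real.log (2 / δ) := Real.log_nonneg (by rw [le_div_iff₀ hδ]; linarith)
  have hI : ∫ S, f S ∂(Measure.pi fun _ : Fin n => μ) ≤ n * B :=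
    N.integral_deviation_le_complexity hL hk hb hη hM hℓ hℓc hn hμ A
  have htail := measure_le_of_bounded_differences μ hf
    (fun S => abs_iSup_deviation_le μ hmeas h0 hM' S) hdiff
    (s := n * (M * τ)) (by positivity)
  have hexp : Real.exp (-(n * (M * τ)) ^ 2 / (n * M ^ 2 / 2)) ≤ δ := by
    -- The one-sided tail at `n * M * τ` equals `δ / 2`, half of the permitted probability.
    have h1 : -(n * (M * τ)) ^ 2 / (n * M ^ 2 / 2) = -Real.log (2 / δ) := by
      have h2 : τ ^ 2 = Real.log (2 / δ) / (2 * n) := Real.sq_sqrt (by positivity)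
      rw [mul_pow, mul_pow, h2]
      field_simp
    rw [h1, Real.exp_neg, Real.exp_log (by positivity), inv_div]
    linarith
  -- Monotonicity suffices, so the exceptional set itself need not be measurable.
  refine le_trans (measure_mono fun S hS => ?_) (htail.trans (ENNReal.ofReal_le_ofReal hexp))
  by_contra hlt
  refine hS fun A' hA' => ?_
  have hlt : f S < ∫ S, f S ∂(Measure.pi fun _ : Fin n => μ) + n * (M * τ) := not_le.1 hlt
  have hcont := N.continuous_deviation (b := b) hM hℓc (μ := μ) S
  have hall : n * ∫ t, N.augLoss b ℓ M A' t ∂μ - ∑ j, N.augLoss b ℓ M A' (S j) ≤ f S :=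
    (TopologicalSpace.denseRange_denseSeq N.params).induction_on
      (p := fun a : N.params =>
        n * ∫ t, N.augLoss b ℓ M a t ∂μ - ∑ j, N.augLoss b ℓ M a (S j) ≤ f S)
      ⟨A', hA'⟩ (isClosed_le hcont continuous_const) fun a => le_ciSup (hbdd S) a
  rw [div_add' _ _ _ hn0.ne', div_add' _ _ _ hn0.ne', le_div_iff₀ hn0]
  linarith

end NetSpec
end DCRL

/-! ### Combination of the transfer and deviation bounds. -/

theorem mainTheorem5 :
    ∃ (C₀ : ℝ) (q : ℕ), 0 < C₀ ∧
      ∀ (L k n : ℕ) (_ : 1 ≤ L) (_ : 1 ≤ k) (_ : 1 ≤ n)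
        (N : DCRL.NetSpec L)
        (b : ℕ → ℝ) (_ : ∀ l ≤ L, 1 ≤ b l)
        -- latent classes, with at least `k + 1` of positive probability
        (𝒞 : Type*) (prior : PMF 𝒞)
        (_ : ∃ T : Fin (k + 1) ↪ 𝒞, ∀ i, prior (T i) ≠ 0)
        -- input space and class-conditional distributions
        (X : Set (DCRL.Euc (N.d 0))) (_ : ∀ x ∈ X, ‖x‖ ≤ 3 * b 0)
        (D : 𝒞 → MeasureTheory.Measure (DCRL.Euc (N.d 0)))
        (_ : ∀ c, MeasureTheory.IsProbabilityMeasure (D c))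
        (_ : ∀ c, ∀ᵐ x ∂(D c), x ∈ X)
        -- label distributions of the tasks
        (lab : (Fin (k + 1) ↪ 𝒞) → PMF (Fin (k + 1)))
        -- the loss
        (η M : ℝ) (_ : 1 ≤ η) (_ : 0 < M)
        (ℓ : (Fin k → ℝ) → ℝ) (_ : ∀ v, 0 ≤ ℓ v)
        (_ : ∀ v w, |ℓ v - ℓ w| ≤ η * ‖v - w‖)
        (_ : ∀ v ∈ N.marginSet k X, ℓ v ≤ M)
        (_ : ConvexOn ℝ (convexHull ℝ (N.marginSet k X)) ℓ)
        (δ : ℝ) (_ : 0 < δ) (_ : δ < 1),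
        DCRL.sampleLaw prior D k n
          {S | ¬ ∀ A : N.Weights, N.IsERM ℓ S A →
            (Summable fun T : Fin (k + 1) ↪ 𝒞 =>
              DCRL.taskProb prior T * (DCRL.taskWeight prior (lab T) T *
                DCRL.supRisk ℓ D (lab T) T (DCRL.meanClassifier D T (N.net A)))) ∧
            ∑' T : Fin (k + 1) ↪ 𝒞,
              DCRL.taskProb prior T * (DCRL.taskWeight prior (lab T) T *
                DCRL.supRisk ℓ D (lab T) T (DCRL.meanClassifier D T (N.net A)))
            ≤ DCRL.empRisk ℓ S (N.net A)
              + 3 * M * Real.sqrt (Real.log (2 / δ) / (2 * n))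
              + C₀ * (max (η * b L ^ 2) M * N.complexity b / Real.sqrt n
                  * Real.log (N.width + 1))
                * Real.log (2 + n + k + max (η * b L ^ 2) M * N.complexity b) ^ q
              + M * N.numViolations b S A / n}
          ≤ ENNReal.ofReal δ := by
  -- The product `56 * 2594 = 145264`, rounded up. Of the two powers of the logarithm, one counts
  -- the scales and one bounds the root of the entropy factor.
  refine ⟨150000, 2, by norm_num, ?_⟩
  intro L k n hL hk hn N b hb 𝒞 prior hT X hX D hD hDX lab η M hη hM ℓ hℓ0 hℓ hℓM hconv δ hδ hδ1
  have hη0 : 0 ≤ η := by linarith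
  have hn0 : (0 : ℝ) < n := by exact_mod_cast hn
  have hℓc : Continuous ℓ := by
    refine (LipschitzWith.of_dist_le_mul (K := η.toNNReal) fun v w => ?_).continuous
    rw [Real.dist_eq, Real.coe_toNNReal _ hη0, dist_eq_norm]
    exact hℓ v w
  have hpos : ∀ c, DCRL.negMass prior c ≠ 0 := fun c => by
    obtain ⟨T, hT⟩ := hT
    -- As `k ≥ 1`, two distinct classes have positive probability, and any `c` differs from one of
    -- them.
    have h01 : T 0 ≠ T (Fin.last k) := fun h => by
      have := T.injective h
      rw [Fin.ext_iff] at this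
      simp at this
      omega
    by_cases h : T 0 = c
    · exact DCRL.negMass_ne_zero prior (z := T (Fin.last k)) (fun h' => h01 (h.trans h'.symm)) (hT _)
    · exact DCRL.negMass_ne_zero prior h (hT _)
  have := DCRL.isProbabilityMeasure_tupleLaw prior D hpos k
  have hball : ∀ c, ∀ᵐ x ∂(D c), x ∈ Metric.closedBall (0 : DCRL.Euc (N.d 0)) (3 * b 0) :=
    fun c => (hDX c).mono fun x hx => by
      rw [mem_closedBall_zero_iff]; exact hX x hx
  have hae := DCRL.ae_tupleLaw_inp prior D hpos k measurableSet_closedBall hball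
  refine le_trans (measure_mono fun S hS => ?_)
    (N.measure_deviation_le (ℓ := ℓ) hL hk hb hη0 hM hℓ hℓc hn hae hδ hδ1)
  intro hdev
  refine hS fun A hA => ?_
  have hAp := hA.1
  obtain ⟨C, hC⟩ := (isCompact_closedBall (0 : DCRL.Euc (N.d 0))
    (3 * b 0)).exists_bound_of_continuousOn (N.continuous_net (A := A)).continuousOn
  have hV : ∀ t : DCRL.Tuple (N.d 0) k, t.inputs ⊆ X →
      DCRL.margins (N.net A) t ∈ N.marginSet k X := fun t ht => ⟨A, hAp, t, ht, rfl⟩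
  obtain ⟨hsum, hle⟩ := DCRL.summable_and_tsum_supRisk_le prior D hpos N.continuous_net
    (fun x hx => hC x (by rw [mem_closedBall_zero_iff]; exact hX x hx)) hV hℓc hconv
    (h := fun t => N.augLoss b ℓ M A t) (N.measurable_augLoss hℓc A)
    (fun t => N.augLoss_nonneg hM A t) (fun t => N.augLoss_le hM A t) hℓ0
    -- On tuples from `X` the loss is at most `M`, so the truncation does not change it and the
    -- augmented loss dominates.
    (fun t ht => le_max_of_le_left (le_min le_rfl (hℓM _ (hV t ht)))) hDX lab
  refine ⟨hsum, hle.trans ((hdev A hAp).trans ?_)⟩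
  have h1 : (∑ j, N.augLoss b ℓ M A (S j)) / n
      ≤ DCRL.empRisk ℓ S (N.net A) + M * N.numViolations b S A / n := by
    rw [DCRL.empRisk, ← add_div]
    gcongr
    exact N.augLoss_le_add hb hM hℓ0 S A
  -- The one-sided argument uses one of the three deviation terms; the other two are nonnegative.
  have h2 : 0 ≤ M * √(Real.log (2 / δ) / (2 * n)) := by positivity
  linarith
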